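/- **Setting.** Let $\xi$ be a random sample with law $P$, let $f(\cdot;\xi):\mathbb R^n\to\mathbb R$ with $f(x;\cdot)$ integrable for every $x$, and consider $\phi^*=\inf_{x\in\mathbb R^n}\phi(x)$, $\phi=F+r$, $F(x)=\mathbb E_\xi[f(x;\xi)]$, where $r:\mathbb R^n\to\mathbb R\cup\{\infty\}$ is proper, closed and convex and $\phi^*>-\infty$. For a real function $h$, $\partial h(x)$ is the set of $v$ with $h(y)\ge h(x)+\langle v,y-x\rangle+o(\|y-x\|)$ as $y\to x$. Put $\operatorname{prox}_{\alpha r}(x)=\arg\min_y\{r(y)+\frac1{2\alpha}\|y-x\|^2\}$ and let $\phi_\lambda(x)=\inf_y\{\phi(y)+\frac1{2\lambda}\|y-x\|^2\}$ be the Moreau envelope. **Algorithm.** Choose a deterministic $x^{(0)}=x^{(1)}\in\operatorname{dom}(r)$ and, for $k=1,2,\dots$, let $$x^{(k+1)}=\operatorname{prox}_{\alpha_k r}\big(x^{(k)}-\alpha_k g^{(k)}+\beta_k(x^{(k)}-x^{(k-1)})\big),\qquad g^{(k)}=\tilde\nabla f(x^{(k-\tau_k)};\xi_k),$$ where $x^{(j)}:=x^{(1)}$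 for $j\le 0$, $\xi_k$ is a sample with law $P$ independent of $\tau_k$ and of all earlier samples and delays, $\tau_k$ is the delay, and $\tilde\nabla f(x;\xi)$ is a subgradient oracle (jointly measurable in $(x,\xi)$; the choice of subgradient may depend on $k$). **Assumptions.** 1. $F+\frac\rho2\|\cdot\|^2$ is convex, where $\rho>0$. 2. For every $x\in\operatorname{dom}(r)$, $\tilde\nabla f(x;\xi)\in\partial f(x;\xi)$ almost surely and $\mathbb E_\xi[\tilde\nabla f(x;\xi)]\in\partial F(x)$. 3. There is $M\ge0$ with $\mathbb E_\xi\|g(\xi)\|^2\le M^2$ for all $x\in\operatorname{dom}(r)$ and all measurable choices of subgradients $g(\xi)\in\partial f(x;\xi)$. 4. There are an integer $\tau\ge 0$ and $p_0,\dots,p_\tau$ with $\sum_{j=0}^\tau p_j=1$ such that $\mathbb P(\tau_k=j)=p_j$ for $0\le j\le\tau$ and all $k\ge1$, and $\tau_k$ is independent of the samples and delays of the earlier iterations. 5. At least one of the following holds: (i) there is $C_\phi$ with $|\phi(x)|\le C_\phi$ for all $x\in\operatorname{dom}(r)$; (ii) $r=r_1+r_2$, where $r_1$ is the indicator function of a closed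 convex set $X$, $r_2:\mathbb R^n\to\mathbb R$ is convex, and there is $M_r\ge0$ with $\|v\|\le M_r$ for all $x\in X$, $v\in\partial r_2(x)$. 6. $|F(x)|\le C_F$ for all $x\in\operatorname{dom}(r)$. **Parameters.** $\overline\rho\in(\rho,2\rho]$, $0<\alpha\le1/\overline\rho$, $0\le\tilde\beta<1-\frac{\alpha\rho}2$, $\beta\ge0$, and $\alpha_k=\alpha/\sqrt k$, $\beta_k=\min\{\tilde\beta,\beta/k^{1/4}\}$ for all $k\ge1$. **Claim.** Let $1\le k_0\le K$ be integers and let $T$ be drawn from $\{k_0,\dots,K\}$, independently of the samples and delays of the iterations $1,\dots,K-1$, with $\mathbb P(T=k)=\alpha_k/\sum_{j=k_0}^K\alpha_j$. Then $\phi_{1/\overline\rho}$ is differentiable, $\phi_{1/\overline\rho}(x^{(k_0)})$ and $\|\nabla\phi_{1/\overline\rho}(x^{(T)})\|^2$ are integrable, and $$\begin{aligned}\mathbb E\|\nabla\phi_{1/\overline\rho}(x^{(T)})\|^2\le\ &\tfrac{\overline\rho}{(\overline\rho-\rho)\alpha(\sqrt{K+1}-\sqrt{k_0})}\Big[\mathbb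 E\big[\phi_{1/\overline\rho}(x^{(k_0)})-\phi^*\big]+4\overline\rho M^2\alpha^2(1+\ln K-\ln k_0)\\&+\tfrac{\overline\rho}2\big(2\tilde\beta^2+\tfrac{2\beta^2}{\alpha(\overline\rho-\rho)}\big)\big(C_1+C_2\alpha^2(1+\ln K)\big)\\&+2\tfrac{\alpha}{\sqrt{k_0}}\overline\rho\tau C_F+\tfrac{\alpha}{\sqrt{k_0}}\tau^2\overline\rho\big(\tfrac\rho2+\tfrac{\rho^2}{\overline\rho-\rho}\big)\big(C_1+C_2\alpha^2(1+\ln K)\big)\\&+\alpha M\tau\overline\rho\sqrt{1+\ln K-\ln k_0}\,\sqrt{C_1+C_2\alpha^2(1+\ln K)}\Big],\end{aligned}$$ where $C_1=\frac{4\alpha C_\phi}{1-\frac{\alpha\rho}2-\tilde\beta}$, $C_2=\frac{4M^2}{(1-\frac{\alpha\rho}2-\tilde\beta)^2}$ if (i) holds, or $C_1=0$, $C_2=(M_r^2+M^2)\frac{4(1+\tilde\beta^2)}{(1-\tilde\beta^2)^2}$ if (ii) holds (if both hold, the bound holds with either pair). -/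

import Mathlib

open MeasureTheory ProbabilityTheory Topology

noncomputable section

namespace InertialSsGM

/-- The (Fréchet) subdifferential of `h` at `x`: all `v` with
`h y ≥ h x + ⟪v, y - x⟫ + o(‖y - x‖)` as `y → x`. -/
def subdifferential {n : ℕ} (h : EuclideanSpace ℝ (Fin n) → ℝ)
    (x : EuclideanSpace ℝ (Fin n)) : Set (EuclideanSpace ℝ (Fin n)) :=
  {v | ∀ ε : ℝ, 0 < ε → ∀ᶠ y in 𝓝 x, h x + inner ℝ v (y - x) - ε * ‖y - x‖ ≤ h y}

/-- `h` is `ρ`-weakly convex: `h + (ρ / 2) ‖·‖²` is convex. -/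
def WeaklyConvex {n : ℕ} (ρ : ℝ) (h : EuclideanSpace ℝ (Fin n) → ℝ) : Prop :=
  ConvexOn ℝ Set.univ fun x => h x + ρ / 2 * ‖x‖ ^ 2

/-- A proper closed (lower semicontinuous) convex function with values in `(-∞, ∞]`. -/
structure ProperClosedConvex {n : ℕ} (r : EuclideanSpace ℝ (Fin n) → EReal) : Prop where
  ne_bot : ∀ x, r x ≠ ⊥
  proper : ∃ x, r x ≠ ⊤
  closed : LowerSemicontinuous r
  convex : Convex ℝ {p : EuclideanSpace ℝ (Fin n) × ℝ | r p.1 ≤ (p.2 : EReal)}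

/-- The effective domain of a function with values in `(-∞, ∞]`. -/
def dom {n : ℕ} (r : EuclideanSpace ℝ (Fin n) → EReal) : Set (EuclideanSpace ℝ (Fin n)) :=
  {x | r x ≠ ⊤}

open Classical in
/-- The indicator function of `X` in the sense of convex analysis: `0` on `X`, `∞` off `X`. -/
def convexIndicator {n : ℕ} (X : Set (EuclideanSpace ℝ (Fin n)))
    (x : EuclideanSpace ℝ (Fin n)) : EReal :=
  if x ∈ X then 0 else ⊤

/-- The expected loss `F x = 𝔼_ξ [f (x; ξ)]`, where `ξ` has law `P`. -/
def expectedLoss {n : ℕ} {Ξ : Type*} [MeasurableSpace Ξ] (P : Measure Ξ)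
    (f : EuclideanSpace ℝ (Fin n) → Ξ → ℝ) (x : EuclideanSpace ℝ (Fin n)) : ℝ :=
  ∫ s, f x s ∂P

/-- The objective `φ = F + r`. -/
def objective {n : ℕ} (F : EuclideanSpace ℝ (Fin n) → ℝ)
    (r : EuclideanSpace ℝ (Fin n) → EReal) (x : EuclideanSpace ℝ (Fin n)) : EReal :=
  (F x : EReal) + r x

/-- The optimal value `φ* = inf φ`, as a real number. -/
def optimalValue {n : ℕ} (φ : EuclideanSpace ℝ (Fin n) → EReal) : ℝ :=
  (⨅ x, φ x).toReal

/-- The Moreau envelope `φ_lam (x) = inf_y { φ y + ‖y - x‖² / (2 lam) }`, as a real number. -/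
def moreauEnvelope {n : ℕ} (φ : EuclideanSpace ℝ (Fin n) → EReal) (lam : ℝ)
    (x : EuclideanSpace ℝ (Fin n)) : ℝ :=
  (⨅ y, φ y + ((1 / (2 * lam) * ‖y - x‖ ^ 2 : ℝ) : EReal)).toReal

/-- `z = prox_{a r} (x)`, i.e. `z` minimizes `y ↦ r y + ‖y - x‖² / (2 a)`. -/
def IsProx {n : ℕ} (r : EuclideanSpace ℝ (Fin n) → EReal) (a : ℝ)
    (x z : EuclideanSpace ℝ (Fin n)) : Prop :=
  ∀ y, r z + ((1 / (2 * a) * ‖z - x‖ ^ 2 : ℝ) : EReal)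
    ≤ r y + ((1 / (2 * a) * ‖y - x‖ ^ 2 : ℝ) : EReal)

/-- `G` is a stochastic subgradient oracle on `dom r`, possibly depending on the iteration `k ≥ 1`:
`G k x s` is a subgradient of `f (·; s)` at `x`, and its mean over the law `P` of the sample is a
subgradient of `F = 𝔼 f`. -/
structure IsUnbiasedOracle {n : ℕ} {Ξ : Type*} [MeasurableSpace Ξ] (P : Measure Ξ)
    (f : EuclideanSpace ℝ (Fin n) → Ξ → ℝ) (r : EuclideanSpace ℝ (Fin n) → EReal)
    (G : ℕ → EuclideanSpace ℝ (Fin n) → Ξ → EuclideanSpace ℝ (Fin n)) : Prop where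
  measurable : ∀ k, 1 ≤ k → Measurable (Function.uncurry (G k))
  mem_subdifferential : ∀ k, 1 ≤ k → ∀ x ∈ dom r,
    ∀ᵐ s ∂P, G k x s ∈ subdifferential (fun y => f y s) x
  unbiased : ∀ k, 1 ≤ k → ∀ x ∈ dom r,
    ∫ s, G k x s ∂P ∈ subdifferential (expectedLoss P f) x

/-- `𝔼 ‖g(ξ)‖² ≤ M²` for every `x ∈ dom r` and every (measurable) choice of subgradients
`g(ξ) ∈ ∂f (x; ξ)`. -/
def BoundedSubgradients {n : ℕ} {Ξ : Type*} [MeasurableSpace Ξ] (P : Measure Ξ)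
    (f : EuclideanSpace ℝ (Fin n) → Ξ → ℝ) (r : EuclideanSpace ℝ (Fin n) → EReal)
    (M : ℝ) : Prop :=
  ∀ x ∈ dom r, ∀ g : Ξ → EuclideanSpace ℝ (Fin n), Measurable g →
    (∀ᵐ s ∂P, g s ∈ subdifferential (fun y => f y s) x) →
    ∫⁻ s, ‖g s‖ₑ ^ 2 ∂P ≤ ENNReal.ofReal (M ^ 2)

/-- The samples and delays of the iterations `1, …, k - 1`. -/
def history {Ω Ξ : Type*} (ξ : ℕ → Ω → Ξ) (τ : ℕ → Ω → ℕ) (k : ℕ) (ω : Ω) :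
    (Set.Ico 1 k → Ξ) × (Set.Ico 1 k → ℕ) :=
  (fun j => ξ j ω, fun j => τ j ω)

/-- The samples `ξ_1, ξ_2, …` have law `P`, and `ξ_k` is independent of the earlier samples and of
the delays up to (and including) that of iteration `k`. -/
structure IsSampling {Ω Ξ : Type*} [MeasurableSpace Ω] [MeasurableSpace Ξ] (μ : Measure Ω)
    (P : Measure Ξ) (ξ : ℕ → Ω → Ξ) (τ : ℕ → Ω → ℕ) : Prop where
  measurable : ∀ k, 1 ≤ k → Measurable (ξ k)
  law : ∀ k, 1 ≤ k → μ.map (ξ k) = P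
  indep : ∀ k, 1 ≤ k → IndepFun (ξ k) (fun ω => (history ξ τ k ω, τ k ω)) μ

/-- The delays all follow the same distribution `(p_0, …, p_τmax)` on `{0, …, τmax}`, and `τ_k` is
independent of the samples and delays of the earlier iterations. -/
structure IsStochasticDelay {Ω Ξ : Type*} [MeasurableSpace Ω] [MeasurableSpace Ξ] (μ : Measure Ω)
    (ξ : ℕ → Ω → Ξ) (τ : ℕ → Ω → ℕ) (τmax : ℕ) (p : ℕ → ℝ) : Prop where
  measurable : ∀ k, 1 ≤ k → Measurable (τ k)
  sum_eq_one : ∑ j ∈ Finset.range (τmax + 1), p j = 1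
  law : ∀ k, 1 ≤ k → ∀ j ≤ τmax, μ.real {ω | τ k ω = j} = p j
  indep : ∀ k, 1 ≤ k → IndepFun (τ k) (history ξ τ k) μ

/-- `x` is the sequence of iterates of the distributed stochastic inertial proximal subgradient
method: `x⁽⁰⁾ = x⁽¹⁾ = x₀ ∈ dom r` and, for `k ≥ 1`,
`x⁽ᵏ⁺¹⁾ = prox_{a_k r} (x⁽ᵏ⁾ - a_k g⁽ᵏ⁾ + b_k (x⁽ᵏ⁾ - x⁽ᵏ⁻¹⁾))` with
`g⁽ᵏ⁾ = G_k (x⁽ᵏ⁻ᵗ⁾, ξ_k)`, `t = τ_k`. Natural subtraction implements the convention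
`x⁽ʲ⁾ = x⁽¹⁾` for `j ≤ 0`. -/
structure IsRun {n : ℕ} {Ω Ξ : Type*} (r : EuclideanSpace ℝ (Fin n) → EReal)
    (G : ℕ → EuclideanSpace ℝ (Fin n) → Ξ → EuclideanSpace ℝ (Fin n))
    (ξ : ℕ → Ω → Ξ) (τ : ℕ → Ω → ℕ) (a b : ℕ → ℝ) (x₀ : EuclideanSpace ℝ (Fin n))
    (x : ℕ → Ω → EuclideanSpace ℝ (Fin n)) : Prop where
  init_mem : x₀ ∈ dom r
  zero : ∀ ω, x 0 ω = x₀
  one : ∀ ω, x 1 ω = x₀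
  step : ∀ k, 1 ≤ k → ∀ ω,
    IsProx r (a k)
      (x k ω - a k • G k (x (k - τ k ω) ω) (ξ k ω) + b k • (x k ω - x (k - 1) ω))
      (x (k + 1) ω)

/-- The output index `T` is drawn from `{k₀, …, K}`, independently of the samples and delays that
determine `x⁽¹⁾, …, x⁽ᴷ⁾`, with `ℙ(T = k) = a_k / ∑_{j = k₀}^K a_j`. -/
structure IsOutputIndex {Ω Ξ : Type*} [MeasurableSpace Ω] [MeasurableSpace Ξ] (μ : Measure Ω)
    (ξ : ℕ → Ω → Ξ) (τ : ℕ → Ω → ℕ) (a : ℕ → ℝ) (k₀ K : ℕ) (T : Ω → ℕ) : Prop where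
  measurable : Measurable T
  law : ∀ k ∈ Finset.Icc k₀ K, μ.real {ω | T ω = k} = a k / ∑ j ∈ Finset.Icc k₀ K, a j
  indep : IndepFun T (history ξ τ K) μ

/-- `φ` is bounded by `Cφ` in absolute value on `dom r`. -/
def BoundedObjective {n : ℕ} (φ r : EuclideanSpace ℝ (Fin n) → EReal) (Cφ : ℝ) : Prop :=
  ∀ x ∈ dom r, |(φ x).toReal| ≤ Cφ

/-- `r` is the sum of the indicator function of a closed convex set `X` and of a convex function
`r₂` all of whose subgradients at points of `X` have norm at most `Mr`. -/
def IndicatorPlusBoundedSubgradients {n : ℕ} (r : EuclideanSpace ℝ (Fin n) → EReal)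
    (Mr : ℝ) : Prop :=
  ∃ (X : Set (EuclideanSpace ℝ (Fin n))) (r₂ : EuclideanSpace ℝ (Fin n) → ℝ),
    IsClosed X ∧ Convex ℝ X ∧ ConvexOn ℝ Set.univ r₂ ∧
    (∀ x, r x = convexIndicator X x + (r₂ x : EReal)) ∧
    ∀ x ∈ X, ∀ v ∈ subdifferential r₂ x, ‖v‖ ≤ Mr

end InertialSsGM

end

open InertialSsGM

/-!
The Moreau envelope `φ_{1/ρbar}` serves as a Lyapunov function: its gradient at `y` is
`ρbar (y - prox y)`, so comparing `x⁽ᵏ⁺¹⁾` with the proximal point of `x⁽ᵏ⁾` for `φ` shows that the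
envelope decreases in expectation by a multiple of `α_k 𝔼 ‖∇φ_{1/ρbar}(x⁽ᵏ⁾)‖²`, up to errors caused
by noise, inertia and delay. Weak convexity bounds the delay error by differences
`F(x⁽ᵏ⁻ʲ⁾) - F(x⁽ᵏ⁾)` of losses and by the drift `‖x⁽ᵏ⁾ - x⁽ᵏ⁻ʲ⁾‖`. Since the law of the delay is
the same at every iteration, the loss differences telescope, and summation by parts against the
decreasing weights `α_k` leaves only `O(α_{k₀} τ C_F)`. Inertia and drift are controlled by
`∑_k 𝔼 ‖x⁽ᵏ⁾ - x⁽ᵏ⁻¹⁾‖²`, for which the proximal step gives a contracting recursion.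
-/

namespace InertialSsGM

open Filter

section StrongConvexity

variable {E : Type*} [NormedAddCommGroup E] [InnerProductSpace ℝ E]
  {D : Set E} {ψ : E → ℝ} {m : ℝ} {x y z : E}

lemma nonneg_of_eventually_nonneg_add_mul {p q : ℝ} (h : ∀ᶠ t in 𝓝[>] (0 : ℝ), 0 ≤ p + t * q) :
    0 ≤ p := by
  have hlim : Tendsto (fun t : ℝ => p + t * q) (𝓝[>] 0) (𝓝 (p + 0 * q)) :=
    (Continuous.tendsto (by fun_prop) 0).mono_left nhdsWithin_le_nhds
  simpa using ge_of_tendsto hlim h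

lemma quadratic_growth_of_isMinOn (hψ : StrongConvexOn D m ψ) (hz : z ∈ D) (hmin : IsMinOn ψ D z)
    (hy : y ∈ D) : ψ z + m / 2 * ‖y - z‖ ^ 2 ≤ ψ y := by
  rw [← sub_nonneg]
  refine nonneg_of_eventually_nonneg_add_mul (q := m / 2 * ‖y - z‖ ^ 2) ?_
  filter_upwards [Ioo_mem_nhdsGT zero_lt_one] with t ⟨ht0, ht1⟩
  have hconv := hψ.2 hz hy (sub_nonneg.2 ht1.le) ht0.le (sub_add_cancel 1 t)
  have hle := hmin (hψ.1 hz hy (sub_nonneg.2 ht1.le) ht0.le (sub_add_cancel 1 t))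
  rw [Set.mem_ofPred_eq] at hle
  simp only [smul_eq_mul, norm_sub_rev z y] at hconv
  refine nonneg_of_mul_nonneg_right (a := t) ?_ ht0
  linarith

lemma strongConvexOn_add_mul_sq_dist (hψ : StrongConvexOn D m ψ) (c : ℝ) (x : E) :
    StrongConvexOn D (m + 2 * c) fun y => ψ y + c * ‖y - x‖ ^ 2 := by
  refine ⟨hψ.1, fun y hy w hw s t hs ht hst => ?_⟩
  have hconv := hψ.2 hy hw hs ht hst
  have hsq : ‖s • y + t • w - x‖ ^ 2
      = s * ‖y - x‖ ^ 2 + t * ‖w - x‖ ^ 2 - s * t * ‖y - w‖ ^ 2 := by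
    obtain rfl := eq_sub_of_add_eq hst
    rw [show (1 - t) • y + t • w - x = (y - x) - t • (y - w) by module,
      show w - x = (y - x) - (y - w) by abel, norm_sub_sq_real (y - x), norm_sub_sq_real (y - x),
      real_inner_smul_right, norm_smul, mul_pow, Real.norm_eq_abs, sq_abs]
    ring
  simp only [smul_eq_mul] at hconv ⊢
  rw [hsq]
  linarith

lemma strongConvexOn_add_convexOn {F R : E → ℝ} (hF : StrongConvexOn D m F)
    (hR : ConvexOn ℝ D R) : StrongConvexOn D m fun y => F y + R y := by
  simpa [StrongConvexOn, Pi.add_def] using! UniformConvexOn.add hF (strongConvexOn_zero.2 hR)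

/-- Halving a segment divides the sum of the quadratic terms of its two halves by two. -/
lemma lipschitz_of_sub_le_add_sq (hD : Convex ℝ D) {L c : ℝ}
    (h : ∀ y ∈ D, ∀ z ∈ D, ψ y - ψ z ≤ L * ‖y - z‖ + c * ‖y - z‖ ^ 2) :
    ∀ y ∈ D, ∀ z ∈ D, ψ y - ψ z ≤ L * ‖y - z‖ := by
  have halving : ∀ k : ℕ, ∀ y ∈ D, ∀ z ∈ D,
      ψ y - ψ z ≤ L * ‖y - z‖ + (1 / 2) ^ k * c * ‖y - z‖ ^ 2 := by
    intro k
    induction k with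
    | zero => simpa using h
    | succ k ih =>
      intro y hy z hz
      have hmid : midpoint ℝ y z ∈ D := hD.midpoint_mem hy hz
      have hleft := ih y hy _ hmid
      have hright := ih _ hmid z hz
      rw [← dist_eq_norm, dist_left_midpoint, dist_eq_norm] at hleft
      rw [← dist_eq_norm, dist_midpoint_right, dist_eq_norm] at hright
      simp only [Real.norm_ofNat] at hleft hright
      rw [pow_succ]
      linarith
  intro y hy z hz
  have hlim : Tendsto (fun k : ℕ => L * ‖y - z‖ + (1 / 2) ^ k * c * ‖y - z‖ ^ 2) atTop
      (𝓝 (L * ‖y - z‖ + 0 * c * ‖y - z‖ ^ 2)) :=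
    (((tendsto_pow_atTop_nhds_zero_of_lt_one (by norm_num) (by norm_num)).mul_const c).mul_const
      _).const_add _
  simpa using ge_of_tendsto' hlim fun k => halving k y hy z hz

lemma exists_dual_le_of_convexOn {V : Type*} [NormedAddCommGroup V] [NormedSpace ℝ V] {h : V → ℝ}
    (hconv : ConvexOn ℝ Set.univ h) (hcont : Continuous h) (x : V) :
    ∃ l : StrongDual ℝ V, ∀ y, h x + l (y - x) ≤ h y := by
  obtain ⟨l, hl⟩ := geometric_hahn_banach_open_point hconv.convex_strict_epigraph
    (by simpa using isOpen_lt (hcont.comp continuous_fst) continuous_snd) (x := (x, h x)) (by simp)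
  have hsplit : ∀ y s, l (y, s) = l (y, 0) + s * l (0, 1) := fun y s => by
    rw [← smul_eq_mul, ← map_smul, ← map_add]
    simp
  have hneg : l (0, 1) < 0 := by
    have := hl (x, h x + 1) (by simp)
    rw [hsplit, hsplit x (h x)] at this
    linarith
  refine ⟨(-(l (0, 1))⁻¹) • l.comp (.inl ℝ V ℝ), fun y => ?_⟩
  have hle : l (y, 0) + h y * l (0, 1) ≤ l (x, 0) + h x * l (0, 1) := by
    rw [← sub_nonneg]
    refine nonneg_of_eventually_nonneg_add_mul (q := -l (0, 1)) ?_
    filter_upwards [self_mem_nhdsWithin] with t ht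
    have := hl (y, h y + t) (by simpa using ht)
    rw [hsplit, hsplit x (h x)] at this
    linarith
  have hdiff : l (y - x, 0) = l (y, 0) - l (x, 0) := by rw [← map_sub]; simp
  have heval : ((-(l (0, 1))⁻¹) • l.comp (.inl ℝ V ℝ)) (y - x)
      = (l (y, 0) - l (x, 0)) / -l (0, 1) := by
    simp [hdiff, div_eq_inv_mul, inv_neg]
  rw [heval, ← le_sub_iff_add_le', div_le_iff₀ (neg_pos.2 hneg)]
  linarith

end StrongConvexity

section ProximalPoints

variable {E : Type*} [NormedAddCommGroup E] [InnerProductSpace ℝ E]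
  {D : Set E} {ψ F R : E → ℝ} {m c lam a b L : ℝ} {x y z x' z' g d : E}

/-- `z` is a proximal point of `x` for the real-valued function `ψ` on `D`, with step `lam`. For an
extended-real-valued function `r`, `IsProx r` is the case `D = dom r`; see `isProx_iff_isProxOn`. -/
def IsProxOn (D : Set E) (ψ : E → ℝ) (lam : ℝ) (x z : E) : Prop :=
  z ∈ D ∧ IsMinOn (fun y => ψ y + 1 / (2 * lam) * ‖y - x‖ ^ 2) D z

lemma IsProxOn.inner_sub_le (h : IsProxOn D ψ lam x z) (hψ : StrongConvexOn D m ψ) (hlam : 0 < lam)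
    (hy : y ∈ D) : inner ℝ (x - z) (y - z) ≤ lam * (ψ y - ψ z - m / 2 * ‖y - z‖ ^ 2) := by
  have hgrowth := quadratic_growth_of_isMinOn (strongConvexOn_add_mul_sq_dist hψ _ x) h.1 h.2 hy
  have hsq : ‖y - x‖ ^ 2 = ‖y - z‖ ^ 2 - 2 * inner ℝ (x - z) (y - z) + ‖z - x‖ ^ 2 := by
    rw [show y - x = (y - z) - (x - z) by abel, norm_sub_sq_real, real_inner_comm,
      norm_sub_rev x z]
  rw [hsq] at hgrowth
  field_simp at hgrowth
  linarith

lemma IsProxOn.sq_dist_le_inner (h : IsProxOn D ψ lam x z) (h' : IsProxOn D ψ lam x' z')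
    (hψ : StrongConvexOn D m ψ) (hlam : 0 < lam) :
    (1 + lam * m) * ‖z - z'‖ ^ 2 ≤ inner ℝ (x - x') (z - z') := by
  have hz := h.inner_sub_le hψ hlam h'.1
  have hz' := h'.inner_sub_le hψ hlam h.1
  have hadd : inner ℝ (x - z) (z' - z) + inner ℝ (x' - z') (z - z')
      = ‖z - z'‖ ^ 2 - inner ℝ (x - x') (z - z') := by
    rw [← real_inner_self_eq_norm_sq, ← neg_sub z z', inner_neg_right, neg_add_eq_sub,
      ← inner_sub_left, ← inner_sub_left]
    congr 1
    abel
  rw [norm_sub_rev z' z] at hz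
  linarith

lemma IsProxOn.mul_dist_le (h : IsProxOn D ψ lam x z) (h' : IsProxOn D ψ lam x' z')
    (hψ : StrongConvexOn D m ψ) (hlam : 0 < lam) :
    (1 + lam * m) * ‖z - z'‖ ≤ ‖x - x'‖ := by
  rcases (norm_nonneg (z - z')).eq_or_lt with hzero | hpos
  · rw [← hzero, mul_zero]
    exact norm_nonneg _
  · refine le_of_mul_le_mul_right ?_ hpos
    calc (1 + lam * m) * ‖z - z'‖ * ‖z - z'‖ = (1 + lam * m) * ‖z - z'‖ ^ 2 := by ring
      _ ≤ inner ℝ (x - x') (z - z') := h.sq_dist_le_inner h' hψ hlam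
      _ ≤ ‖x - x'‖ * ‖z - z'‖ := real_inner_le_norm _ _

lemma lipschitzWith_of_isProxOn {Z : E → E} (hZ : ∀ x, IsProxOn D ψ lam x (Z x))
    (hψ : StrongConvexOn D m ψ) (hlam : 0 < lam) (hm : 0 < 1 + lam * m) :
    LipschitzWith (1 + lam * m)⁻¹.toNNReal Z := by
  refine LipschitzWith.of_dist_le_mul fun x y => ?_
  rw [Real.coe_toNNReal _ (inv_nonneg.2 hm.le), ← div_eq_inv_mul, le_div_iff₀' hm, dist_eq_norm,
    dist_eq_norm]
  exact (hZ x).mul_dist_le (hZ y) hψ hlam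

section Envelope

variable {Φ : E → ℝ} {Z : E → E}

lemma envelope_le_add_inner (hZ : ∀ x, IsProxOn D ψ lam x (Z x))
    (hΦ : ∀ x, Φ x = ψ (Z x) + 1 / (2 * lam) * ‖Z x - x‖ ^ 2) (x y : E) :
    Φ y ≤ Φ x + inner ℝ (lam⁻¹ • (x - Z x)) (y - x) + 1 / (2 * lam) * ‖y - x‖ ^ 2 := by
  have hmin : Φ y ≤ ψ (Z x) + 1 / (2 * lam) * ‖Z x - y‖ ^ 2 := (hΦ y).trans_le ((hZ y).2 (hZ x).1)
  have hsq : ‖y - Z x‖ ^ 2 = ‖x - Z x‖ ^ 2 + 2 * inner ℝ (x - Z x) (y - x) + ‖y - x‖ ^ 2 := by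
    rw [show y - Z x = (x - Z x) + (y - x) by abel, norm_add_sq_real]
  refine hmin.trans_eq ?_
  rw [hΦ x, norm_sub_rev _ y, norm_sub_rev _ x, hsq, real_inner_smul_left]
  ring

lemma hasGradientAt_envelope [CompleteSpace E] (hψ : StrongConvexOn D m ψ) (hlam : 0 < lam)
    (hm : 0 < 1 + lam * m) (hZ : ∀ x, IsProxOn D ψ lam x (Z x))
    (hΦ : ∀ x, Φ x = ψ (Z x) + 1 / (2 * lam) * ‖Z x - x‖ ^ 2) (x : E) :
    HasGradientAt Φ (lam⁻¹ • (x - Z x)) x := by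
  set C := 1 / (2 * lam) + lam⁻¹ * (1 + lam * m)⁻¹ with hC
  have hbound : ∀ y, |Φ y - Φ x - inner ℝ (lam⁻¹ • (x - Z x)) (y - x)| ≤ C * ‖y - x‖ ^ 2 := by
    intro y
    have hupper := envelope_le_add_inner hZ hΦ x y
    have hlower := envelope_le_add_inner hZ hΦ y x
    have hswap : inner ℝ (lam⁻¹ • (y - Z y)) (x - y) = -inner ℝ (lam⁻¹ • (x - Z x)) (y - x)
        - lam⁻¹ * (‖y - x‖ ^ 2 - inner ℝ (Z y - Z x) (y - x)) := by
      simp only [← real_inner_self_eq_norm_sq, real_inner_smul_left, inner_sub_left,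
        inner_sub_right]
      ring
    have hprox : inner ℝ (Z y - Z x) (y - x) ≤ (1 + lam * m)⁻¹ * ‖y - x‖ ^ 2 := by
      have hdist := (hZ y).mul_dist_le (hZ x) hψ hlam
      rw [← le_div_iff₀' hm, div_eq_inv_mul] at hdist
      calc inner ℝ (Z y - Z x) (y - x) ≤ ‖Z y - Z x‖ * ‖y - x‖ := real_inner_le_norm _ _
        _ ≤ (1 + lam * m)⁻¹ * ‖y - x‖ * ‖y - x‖ := by gcongr
        _ = (1 + lam * m)⁻¹ * ‖y - x‖ ^ 2 := by ring
    have hscaled := mul_le_mul_of_nonneg_left hprox (inv_nonneg.2 hlam.le)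
    have hsq : 0 ≤ lam⁻¹ * ‖y - x‖ ^ 2 := by positivity
    have hsq' : 0 ≤ lam⁻¹ * ((1 + lam * m)⁻¹ * ‖y - x‖ ^ 2) := by positivity
    rw [norm_sub_rev x y, hswap] at hlower
    rw [abs_le, hC]
    constructor <;> linarith
  rw [hasGradientAt_iff_isLittleO]
  have hsq : (fun y => ‖y - x‖ ^ 2) =o[𝓝 x] fun y => y - x :=
    (Asymptotics.isLittleO_norm_pow_id one_lt_two).comp_tendsto
      (by simpa using (continuous_sub_right x).tendsto x)
  refine (Asymptotics.IsBigO.of_bound C (.of_forall fun y => ?_)).trans_isLittleO hsq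
  rw [Real.norm_eq_abs, Real.norm_of_nonneg (by positivity)]
  exact hbound y

end Envelope

/-- This replaces the optimality condition `lam⁻¹ • (x - z) ∈ ∂F z + ∂R z`: no subgradient of `F` at
`z` has to be related to the Lipschitz constant of `F` on `D`. -/
lemma IsProxOn.inner_sub_le_of_lipschitz (h : IsProxOn D (fun y => F y + R y) lam x z)
    (hF : StrongConvexOn D m F) (hR : ConvexOn ℝ D R)
    (hLip : ∀ y ∈ D, ∀ y' ∈ D, F y - F y' ≤ L * ‖y - y'‖) (hc : c ∈ Set.Icc 0 1)
    (hx : x ∈ D) (hy : y ∈ D) :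
    1 / lam * inner ℝ (x - z) (y - z) ≤ c * (F x - F z - m / 2 * ‖x - z‖ ^ 2)
      + L * ‖(y - z) - c • (x - z)‖ + (R y - R z) := by
  rw [← sub_nonneg]
  refine nonneg_of_eventually_nonneg_add_mul
    (q := 1 / (2 * lam) * ‖y - z‖ ^ 2 + c ^ 2 * (m / 2 * ‖x - z‖ ^ 2)) ?_
  filter_upwards [Ioo_mem_nhdsGT zero_lt_one] with t ⟨ht0, ht1⟩
  have htc0 : 0 ≤ t * c := mul_nonneg ht0.le hc.1
  have htc1 : t * c ≤ 1 := mul_le_one₀ ht1.le hc.1 hc.2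
  have hline : ∀ (s : ℝ) (w : E), (1 - s) • z + s • w = z + s • (w - z) := fun s w => by module
  have hyt := hF.1 h.1 hy (sub_nonneg.2 ht1.le) ht0.le (sub_add_cancel 1 t)
  have hxt := hF.1 h.1 hx (sub_nonneg.2 htc1) htc0 (sub_add_cancel 1 (t * c))
  have hmin := h.2 hyt
  have hRt := hR.2 h.1 hy (sub_nonneg.2 ht1.le) ht0.le (sub_add_cancel 1 t)
  have hFt := hF.2 h.1 hx (sub_nonneg.2 htc1) htc0 (sub_add_cancel 1 (t * c))
  have hFyx := hLip _ hyt _ hxt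
  have hsq : ‖z + t • (y - z) - x‖ ^ 2
      = ‖z - x‖ ^ 2 - 2 * t * inner ℝ (x - z) (y - z) + t ^ 2 * ‖y - z‖ ^ 2 := by
    rw [show z + t • (y - z) - x = t • (y - z) - (x - z) by abel, norm_sub_sq_real, norm_smul,
      real_inner_smul_left, mul_pow, Real.norm_eq_abs, sq_abs, norm_sub_rev x z, real_inner_comm]
    ring
  have hgap : ‖z + t • (y - z) - (z + (t * c) • (x - z))‖ = t * ‖(y - z) - c • (x - z)‖ := by
    rw [← Real.norm_of_nonneg ht0.le, ← norm_smul, Real.norm_of_nonneg ht0.le]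
    congr 1
    module
  simp only [Set.mem_ofPred_eq] at hmin
  rw [hline, hsq] at hmin
  simp only [hline, smul_eq_mul, norm_sub_rev z x] at hRt hFt
  rw [hline, hline, hgap] at hFyx
  have hcoeff : 1 / (2 * lam) * (2 * t * inner ℝ (x - z) (y - z))
      = t * (1 / lam * inner ℝ (x - z) (y - z)) := by
    rw [one_div_mul_eq_div, one_div_mul_eq_div, mul_assoc, mul_div_mul_left _ _ two_ne_zero,
      mul_div_assoc]
  refine nonneg_of_mul_nonneg_right (a := t) ?_ ht0
  linarith

lemma norm_add_sq_le_of_inner_sub_le {A e v : E} {s q : ℝ}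
    (h : inner ℝ (e - v) (e + A) ≤ s + q * ‖e‖) :
    ‖e + A‖ ^ 2 ≤ ‖A‖ ^ 2 + 2 * inner ℝ v A + 2 * s + (‖v‖ + q) ^ 2 := by
  have hsplit : inner ℝ (e - v) (e + A)
      = ‖e‖ ^ 2 + inner ℝ e A - inner ℝ v e - inner ℝ v A := by
    rw [inner_sub_left, inner_add_right, inner_add_right, real_inner_self_eq_norm_sq]
    ring
  rw [hsplit] at h
  rw [norm_add_sq_real]
  linarith [real_inner_le_norm v e, sq_nonneg (‖v‖ + q - ‖e‖)]

lemma sq_norm_smul_sub_smul_add_le (ha : 0 ≤ a) (hL : 0 ≤ L) :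
    (‖b • d - a • g‖ + a * L) ^ 2 ≤ 2 * b ^ 2 * ‖d‖ ^ 2 + 4 * a ^ 2 * (‖g‖ ^ 2 + L ^ 2) := by
  have hnorm : ‖b • d - a • g‖ ≤ |b| * ‖d‖ + a * ‖g‖ := by
    refine (norm_sub_le _ _).trans_eq ?_
    rw [norm_smul, norm_smul, Real.norm_eq_abs, Real.norm_of_nonneg ha]
  calc (‖b • d - a • g‖ + a * L) ^ 2 ≤ (|b| * ‖d‖ + a * (‖g‖ + L)) ^ 2 := by
        exact pow_le_pow_left₀ (by positivity) (by linarith) 2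
    _ ≤ 2 * ((|b| * ‖d‖) ^ 2 + (a * (‖g‖ + L)) ^ 2) := add_sq_le
    _ ≤ 2 * ((|b| * ‖d‖) ^ 2 + a ^ 2 * (2 * (‖g‖ ^ 2 + L ^ 2))) := by
        rw [mul_pow a]
        gcongr
        exact add_sq_le
    _ = 2 * b ^ 2 * ‖d‖ ^ 2 + 4 * a ^ 2 * (‖g‖ ^ 2 + L ^ 2) := by
        rw [mul_pow, sq_abs]
        ring

lemma IsProxOn.sq_dist_step_le (h : IsProxOn D (fun y => F y + R y) lam x z)
    (hF : StrongConvexOn D m F) (hR : ConvexOn ℝ D R) (hL : 0 ≤ L)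
    (hLip : ∀ y ∈ D, ∀ y' ∈ D, F y - F y' ≤ L * ‖y - y'‖)
    (ha : 0 < a) (hlam : 0 < lam) (hal : a ≤ lam) (hx : x ∈ D)
    (hy : IsProxOn D R a (x - a • g + b • d) y) :
    ‖y - z‖ ^ 2 ≤ (1 - a / lam) ^ 2 * ‖x - z‖ ^ 2
      + 2 * (1 - a / lam) * (b * inner ℝ (x - z) d - a * inner ℝ (x - z) g)
      + 2 * a * (1 - a / lam) * (F x - F z - m / 2 * ‖x - z‖ ^ 2)
      + 2 * b ^ 2 * ‖d‖ ^ 2 + 4 * a ^ 2 * (‖g‖ ^ 2 + L ^ 2) := by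
  set c := 1 - a / lam with hc
  have hc01 : c ∈ Set.Icc 0 1 :=
    ⟨sub_nonneg.2 ((div_le_one hlam).2 hal), sub_le_self _ (div_nonneg ha.le hlam.le)⟩
  have hz := h.inner_sub_le_of_lipschitz hF hR hLip hc01 hx hy.1
  have hstep := hy.inner_sub_le (strongConvexOn_zero.2 hR) ha h.1
  set e := (y - z) - c • (x - z) with he
  set v := b • d - a • g with hv
  have heA : e + c • (x - z) = y - z := sub_add_cancel _ _
  have hinner : inner ℝ (e - v) (e + c • (x - z))
      = inner ℝ (x - a • g + b • d - y) (z - y) + a * (1 / lam * inner ℝ (x - z) (y - z)) := by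
    have hvec : e - v = (a * (1 / lam)) • (x - z) - (x - a • g + b • d - y) := by
      rw [he, hv, hc, mul_one_div]
      module
    rw [heA, hvec, inner_sub_left, real_inner_smul_left, ← neg_sub z y, inner_neg_right,
      inner_neg_right]
    ring
  have hkey : inner ℝ (e - v) (e + c • (x - z))
      ≤ a * (c * (F x - F z - m / 2 * ‖x - z‖ ^ 2)) + a * L * ‖e‖ := by
    have := mul_le_mul_of_nonneg_left hz ha.le
    linarith
  have hsq := norm_add_sq_le_of_inner_sub_le hkey
  have hvA : inner ℝ v (c • (x - z)) = c * (b * inner ℝ (x - z) d - a * inner ℝ (x - z) g) := by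
    rw [hv, real_inner_smul_right, real_inner_comm, inner_sub_right, real_inner_smul_right,
      real_inner_smul_right]
  rw [heA, hvA, norm_smul, mul_pow, Real.norm_eq_abs, sq_abs] at hsq
  linarith [sq_norm_smul_sub_smul_add_le (b := b) (d := d) (g := g) ha.le hL]

lemma IsProxOn.sq_norm_step_le (hR : ConvexOn ℝ D R) (ha : 0 < a) (hb : 0 ≤ b) (hx : x ∈ D)
    (hy : IsProxOn D R a (x - a • g + b • d) y) :
    ‖y - x‖ ^ 2 ≤ (b * ‖d‖ + a * ‖g‖) * ‖y - x‖ + a * (R x - R y) := by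
  have hvar := hy.inner_sub_le (strongConvexOn_zero.2 hR) ha hx
  have hexpand : inner ℝ (x - a • g + b • d - y) (x - y)
      = ‖y - x‖ ^ 2 - b * inner ℝ d (y - x) + a * inner ℝ g (y - x) := by
    rw [show x - a • g + b • d - y = b • d - a • g - (y - x) by abel, ← neg_sub y x,
      inner_neg_right, inner_sub_left, inner_sub_left, real_inner_self_eq_norm_sq,
      real_inner_smul_left, real_inner_smul_left]
    ring
  have hd := mul_le_mul_of_nonneg_left (real_inner_le_norm d (y - x)) hb
  have hg := mul_le_mul_of_nonneg_left (neg_le_of_abs_le (abs_real_inner_le_norm g (y - x))) ha.le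
  rw [hexpand] at hvar
  linarith

end ProximalPoints

section ScalarInequalities

variable {u v q β e : ℝ}

lemma half_sq_le_of_sq_le_mul_add (hβ : 0 ≤ β) (hβ1 : β < 1)
    (h : u ^ 2 ≤ (β * v + q) * u + e) :
    u ^ 2 / 2 ≤ β / 2 * v ^ 2 + q ^ 2 / (2 * (1 - β)) + e := by
  have hpos : 0 < 1 - β := sub_pos.2 hβ1
  have hyoung : q * u ≤ (1 - β) / 2 * u ^ 2 + q ^ 2 / (2 * (1 - β)) := by
    have hsq : (1 - β) / 2 * u ^ 2 + q ^ 2 / (2 * (1 - β)) - q * u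
        = ((1 - β) * u - q) ^ 2 / (2 * (1 - β)) := by
      field_simp
      ring
    rw [← sub_nonneg, hsq]
    positivity
  linarith [mul_nonneg hβ (sq_nonneg (v - u))]

lemma sq_mul_add_le (hβ : β ^ 2 < 1) :
    (β * v + q) ^ 2 ≤ (1 + β ^ 2) / 2 * v ^ 2 + (1 + β ^ 2) / (1 - β ^ 2) * q ^ 2 := by
  have hpos : 0 < 1 - β ^ 2 := sub_pos.2 hβ
  have hsq : (1 + β ^ 2) / 2 * v ^ 2 + (1 + β ^ 2) / (1 - β ^ 2) * q ^ 2 - (β * v + q) ^ 2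
      = ((1 - β ^ 2) * v - 2 * β * q) ^ 2 / (2 * (1 - β ^ 2)) := by
    field_simp
    ring
  rw [← sub_nonneg, hsq]
  positivity

lemma sq_mul_add_le_two_mul (a u v : ℝ) : (a * (u + v)) ^ 2 ≤ 2 * (a ^ 2 * (u ^ 2 + v ^ 2)) := by
  rw [mul_pow, mul_left_comm]
  exact mul_le_mul_of_nonneg_left add_sq_le (sq_nonneg a)

end ScalarInequalities

section Subdifferential

variable {n : ℕ} {F h : EuclideanSpace ℝ (Fin n) → ℝ} {D : Set (EuclideanSpace ℝ (Fin n))}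
  {x y v : EuclideanSpace ℝ (Fin n)} {ρ m : ℝ}

lemma WeaklyConvex.strongConvexOn (hF : WeaklyConvex ρ F) (hD : Convex ℝ D) :
    StrongConvexOn D (-ρ) F :=
  strongConvexOn_iff_convex.2 <| (ConvexOn.subset hF (Set.subset_univ D) hD).congr
    fun x _ => by ring

lemma WeaklyConvex.continuous (hF : WeaklyConvex ρ F) : Continuous F := by
  have hsum : Continuous fun x => F x + ρ / 2 * ‖x‖ ^ 2 := (ConvexOn.locallyLipschitz hF).continuous
  exact (hsum.sub (by fun_prop : Continuous fun x => ρ / 2 * ‖x‖ ^ 2)).congr fun x =>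
    add_sub_cancel_right _ _

lemma le_of_mem_subdifferential (hF : StrongConvexOn D m F) (hx : x ∈ D) (hy : y ∈ D)
    (hv : v ∈ subdifferential F x) : F x + inner ℝ v (y - x) + m / 2 * ‖y - x‖ ^ 2 ≤ F y := by
  rw [← sub_nonneg]
  refine nonneg_of_eventually_nonneg_add_mul (q := ‖y - x‖) ?_
  filter_upwards [self_mem_nhdsWithin] with ε (hε : 0 < ε)
  refine nonneg_of_eventually_nonneg_add_mul (q := m / 2 * ‖y - x‖ ^ 2) ?_
  have hsegment : Tendsto (fun t : ℝ => x + t • (y - x)) (𝓝[>] 0) (𝓝 x) := by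
    have hcont : Continuous fun t : ℝ => x + t • (y - x) := by fun_prop
    simpa using (hcont.tendsto 0).mono_left nhdsWithin_le_nhds
  filter_upwards [hsegment.eventually (hv ε hε), Ioo_mem_nhdsGT zero_lt_one] with t ht ⟨ht0, ht1⟩
  have hconv := hF.2 hx hy (sub_nonneg.2 ht1.le) ht0.le (sub_add_cancel 1 t)
  rw [show (1 - t) • x + t • y = x + t • (y - x) by module] at hconv
  rw [add_sub_cancel_left, inner_smul_right, norm_smul, Real.norm_of_nonneg ht0.le] at ht
  simp only [smul_eq_mul, norm_sub_rev x y] at hconv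
  refine nonneg_of_mul_nonneg_right (a := t) ?_ ht0
  linarith

lemma exists_mem_subdifferential (hh : ConvexOn ℝ Set.univ h) (x : EuclideanSpace ℝ (Fin n)) :
    ∃ v, v ∈ subdifferential h x := by
  obtain ⟨l, hl⟩ := exists_dual_le_of_convexOn hh hh.locallyLipschitz.continuous x
  refine ⟨(InnerProductSpace.toDual ℝ _).symm l, fun ε hε => .of_forall fun y => ?_⟩
  rw [InnerProductSpace.toDual_symm_apply]
  linarith [hl y, mul_nonneg hε.le (norm_nonneg (y - x))]

lemma sub_le_mul_norm_of_subgradient_le {L : ℝ} (hF : StrongConvexOn D m F) (hx : x ∈ D)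
    (hy : y ∈ D) (hv : v ∈ subdifferential F x) (hvL : ‖v‖ ≤ L) :
    F x - F y ≤ L * ‖x - y‖ + -m / 2 * ‖x - y‖ ^ 2 := by
  have hsub := le_of_mem_subdifferential hF hx hy hv
  have hinner := neg_le_of_abs_le (abs_real_inner_le_norm v (y - x))
  have hnorm := mul_le_mul_of_nonneg_right hvL (norm_nonneg (y - x))
  rw [norm_sub_rev x y]
  linarith

end Subdifferential

section ExtendedReal

variable {n : ℕ} {φ r : EuclideanSpace ℝ (Fin n) → EReal} {F : EuclideanSpace ℝ (Fin n) → ℝ}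
  {x y z : EuclideanSpace ℝ (Fin n)} {a lam : ℝ}

lemma isProx_iff_isProxOn (hbot : ∀ y, φ y ≠ ⊥) (hdom : (dom φ).Nonempty) :
    IsProx φ a x z ↔ IsProxOn (dom φ) (fun y => (φ y).toReal) a x z := by
  have hcoe : ∀ y ∈ dom φ, φ y + ((1 / (2 * a) * ‖y - x‖ ^ 2 : ℝ) : EReal)
      = (((φ y).toReal + 1 / (2 * a) * ‖y - x‖ ^ 2 : ℝ) : EReal) := fun y hy => by
    rw [EReal.coe_add, EReal.coe_toReal hy (hbot y)]
  constructor
  · intro h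
    have hz : z ∈ dom φ := by
      obtain ⟨y, hy⟩ := hdom
      intro hz
      have := h y
      rw [hz, EReal.top_add_coe, hcoe y hy] at this
      exact EReal.coe_ne_top _ (top_le_iff.1 this)
    refine ⟨hz, fun y hy => ?_⟩
    have := h y
    rwa [hcoe z hz, hcoe y hy, EReal.coe_le_coe_iff] at this
  · rintro ⟨hz, hmin⟩ y
    by_cases hy : y ∈ dom φ
    · rw [hcoe z hz, hcoe y hy, EReal.coe_le_coe_iff]
      exact hmin hy
    · rw [not_not.1 hy, EReal.top_add_coe]
      exact le_top

lemma exists_isProx (hbot : ∀ y, φ y ≠ ⊥) (hdom : (dom φ).Nonempty) (hlsc : LowerSemicontinuous φ)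
    {B : ℝ} (hB : ∀ y ∈ dom φ, B ≤ (φ y).toReal) (ha : 0 < a) (x : EuclideanSpace ℝ (Fin n)) :
    ∃ z, IsProx φ a x z := by
  obtain ⟨y₀, hy₀⟩ := hdom
  obtain ⟨c, hc⟩ : ∃ c, 1 / (2 * a) = c := ⟨_, rfl⟩
  have hcpos : 0 < c := by rw [← hc]; positivity
  simp only [IsProx, hc]
  set S := Metric.closedBall x √(((φ y₀).toReal + c * ‖y₀ - x‖ ^ 2 - B) / c) with hS
  have hmemS : ∀ y, (φ y).toReal + c * ‖y - x‖ ^ 2 ≤ (φ y₀).toReal + c * ‖y₀ - x‖ ^ 2 →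
      y ∈ dom φ → y ∈ S := fun y hy hyd => by
    rw [hS, mem_closedBall_iff_norm]
    refine Real.le_sqrt_of_sq_le ((le_div_iff₀' hcpos).2 ?_)
    linarith [hB y hyd]
  have hy₀S : y₀ ∈ S := hmemS y₀ le_rfl hy₀
  have hlsc' : LowerSemicontinuous fun y => φ y + ((c * ‖y - x‖ ^ 2 : ℝ) : EReal) :=
    hlsc.add' (continuous_coe_real_ereal.comp (by fun_prop)).lowerSemicontinuous
      fun y => EReal.continuousAt_add (.inr (EReal.coe_ne_bot _)) (.inr (EReal.coe_ne_top _))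
  obtain ⟨z, -, hmin⟩ :=
    (hlsc'.lowerSemicontinuousOn S).exists_isMinOn ⟨y₀, hy₀S⟩ (isCompact_closedBall _ _)
  refine ⟨z, fun y => ?_⟩
  by_cases hyS : y ∈ S
  · exact hmin hyS
  · refine (hmin hy₀S).trans ?_
    by_cases hy : y ∈ dom φ
    · simp only
      rw [← EReal.coe_toReal hy₀ (hbot y₀), ← EReal.coe_toReal hy (hbot y), ← EReal.coe_add,
        ← EReal.coe_add, EReal.coe_le_coe_iff]
      exact le_of_not_ge fun hle => hyS (hmemS y hle hy)
    · rw [not_not.1 hy, EReal.top_add_coe]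
      exact le_top

lemma optimalValue_le (hbdd : ⊥ < ⨅ y, φ y) (hy : y ∈ dom φ) : optimalValue φ ≤ (φ y).toReal :=
  EReal.toReal_le_toReal (iInf_le φ y) hbdd.ne' hy

lemma moreauEnvelope_eq (h : IsProx φ lam x z) (hbot : φ z ≠ ⊥) (htop : φ z ≠ ⊤) :
    moreauEnvelope φ lam x = (φ z).toReal + 1 / (2 * lam) * ‖z - x‖ ^ 2 := by
  have hmin : ⨅ y, φ y + ((1 / (2 * lam) * ‖y - x‖ ^ 2 : ℝ) : EReal)
      = φ z + ((1 / (2 * lam) * ‖z - x‖ ^ 2 : ℝ) : EReal) := le_antisymm (iInf_le _ z) (le_iInf h)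
  rw [moreauEnvelope, hmin, EReal.toReal_add htop hbot (EReal.coe_ne_top _) (EReal.coe_ne_bot _),
    EReal.toReal_coe]

lemma objective_ne_bot (hbot : r x ≠ ⊥) : objective F r x ≠ ⊥ := by
  simp [objective, EReal.add_eq_bot_iff, hbot]

lemma dom_objective : dom (objective F r) = dom r := by
  ext x
  refine not_congr ⟨fun h => ?_, fun h => ?_⟩
  · by_contra hx
    exact EReal.add_ne_top (EReal.coe_ne_top _) hx h
  · rw [objective, h, EReal.coe_add_top]

lemma toReal_objective (hbot : r x ≠ ⊥) (hx : x ∈ dom r) :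
    (objective F r x).toReal = F x + (r x).toReal := by
  rw [objective, EReal.toReal_add (EReal.coe_ne_top _) (EReal.coe_ne_bot _) hx hbot,
    EReal.toReal_coe]

namespace ProperClosedConvex

lemma convexOn_toReal (hr : ProperClosedConvex r) : ConvexOn ℝ (dom r) fun x => (r x).toReal := by
  have hcomb : ∀ ⦃x⦄, x ∈ dom r → ∀ ⦃y⦄, y ∈ dom r → ∀ ⦃s t : ℝ⦄, 0 ≤ s → 0 ≤ t → s + t = 1 →
      r (s • x + t • y) ≤ ((s * (r x).toReal + t * (r y).toReal : ℝ) : EReal) := by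
    intro x hx y hy s t hs ht hst
    have := hr.convex (x := (x, (r x).toReal)) (EReal.coe_toReal hx (hr.ne_bot x)).ge
      (y := (y, (r y).toReal)) (EReal.coe_toReal hy (hr.ne_bot y)).ge hs ht hst
    simpa using this
  have hmem : Convex ℝ (dom r) := fun x hx y hy s t hs ht hst =>
    ne_top_of_le_ne_top (EReal.coe_ne_top _) (hcomb hx hy hs ht hst)
  refine ⟨hmem, fun x hx y hy s t hs ht hst => ?_⟩
  have hle := hcomb hx hy hs ht hst
  rwa [← EReal.coe_toReal (hmem hx hy hs ht hst) (hr.ne_bot _), EReal.coe_le_coe_iff] at hle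

lemma isProxOn (hr : ProperClosedConvex r) (h : IsProx r a x z) :
    IsProxOn (dom r) (fun y => (r y).toReal) a x z :=
  (isProx_iff_isProxOn hr.ne_bot hr.proper).1 h

lemma isProxOn_objective (hr : ProperClosedConvex r) (h : IsProx (objective F r) a x z) :
    IsProxOn (dom r) (fun y => F y + (r y).toReal) a x z := by
  obtain ⟨hz, hmin⟩ := (isProx_iff_isProxOn (fun y => objective_ne_bot (hr.ne_bot y))
    (dom_objective (F := F) (r := r) ▸ hr.proper)).1 h
  rw [dom_objective] at hz hmin
  refine ⟨hz, fun y hy => ?_⟩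
  have hle := hmin hy
  simp only [Set.mem_ofPred_eq, toReal_objective (F := F) (hr.ne_bot z) hz,
    toReal_objective (F := F) (hr.ne_bot y) hy] at hle ⊢
  exact hle

lemma lowerSemicontinuous_objective (hr : ProperClosedConvex r) (hF : Continuous F) :
    LowerSemicontinuous (objective F r) :=
  (continuous_coe_real_ereal.comp hF).lowerSemicontinuous.add' hr.closed fun _ =>
    EReal.continuousAt_add (.inl (EReal.coe_ne_top _)) (.inl (EReal.coe_ne_bot _))

lemma moreauEnvelope_objective_eq (hr : ProperClosedConvex r) (h : IsProx (objective F r) lam x z) :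
    moreauEnvelope (objective F r) lam x
      = F z + (r z).toReal + 1 / (2 * lam) * ‖z - x‖ ^ 2 := by
  have hz := (hr.isProxOn_objective h).1
  rw [moreauEnvelope_eq h (objective_ne_bot (hr.ne_bot z))
    (show z ∈ dom (objective F r) by rwa [dom_objective]), toReal_objective (hr.ne_bot z) hz]

lemma optimalValue_le (hr : ProperClosedConvex r) (hbdd : ⊥ < ⨅ y, objective F r y)
    (hy : y ∈ dom r) : optimalValue (objective F r) ≤ F y + (r y).toReal := by
  rw [← toReal_objective (hr.ne_bot y) hy]
  exact InertialSsGM.optimalValue_le hbdd (by rwa [dom_objective])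

end ProperClosedConvex

lemma IndicatorPlusBoundedSubgradients.toReal_sub_le {Mr : ℝ}
    (h : IndicatorPlusBoundedSubgradients r Mr) (hx : x ∈ dom r) (hy : y ∈ dom r) :
    (r x).toReal - (r y).toReal ≤ Mr * ‖x - y‖ := by
  obtain ⟨X, r₂, -, -, hconv, hr, hbd⟩ := h
  have hmem : ∀ {x}, x ∈ dom r → x ∈ X ∧ (r x).toReal = r₂ x := by
    intro x hx
    have hxX : x ∈ X := by
      by_contra hxX
      exact hx (by rw [hr x, convexIndicator, if_neg hxX, EReal.top_add_coe])
    exact ⟨hxX, by rw [hr x, convexIndicator, if_pos hxX, zero_add, EReal.toReal_coe]⟩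
  obtain ⟨v, hv⟩ := exists_mem_subdifferential hconv x
  rw [(hmem hx).2, (hmem hy).2]
  simpa using sub_le_mul_norm_of_subgradient_le (strongConvexOn_zero.2 hconv) (Set.mem_univ x)
    (Set.mem_univ y) hv (hbd x (hmem hx).1 v hv)

end ExtendedReal

section Moments

variable {Ω : Type*} [MeasurableSpace Ω] {μ : Measure Ω}
  {V W : Type*} [NormedAddCommGroup V] [NormedAddCommGroup W] {u : Ω → V}

lemma integrable_sq_norm_of_memLp (hu : MemLp u 2 μ) : Integrable (fun ω => ‖u ω‖ ^ 2) μ :=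
  (memLp_two_iff_integrable_sq_norm hu.1).1 hu

lemma integrable_inner_of_memLp [InnerProductSpace ℝ V] {v : Ω → V} (hu : MemLp u 2 μ)
    (hv : MemLp v 2 μ) : Integrable (fun ω => inner ℝ (u ω) (v ω)) μ :=
  (hu.norm.integrable_mul hv.norm).mono' (hu.1.inner hv.1)
    (.of_forall fun _ => norm_inner_le_norm _ _)

lemma integral_norm_le_sqrt [IsProbabilityMeasure μ] (hu : MemLp u 2 μ) :
    ∫ ω, ‖u ω‖ ∂μ ≤ √(∫ ω, ‖u ω‖ ^ 2 ∂μ) := by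
  have hvar := variance_nonneg (fun ω => ‖u ω‖) μ
  rw [variance_eq_sub hu.norm, sub_nonneg] at hvar
  exact Real.le_sqrt_of_sq_le hvar

lemma memLp_two_of_lintegral_sq_le {C : ℝ} (hu : AEStronglyMeasurable u μ)
    (hC : ∫⁻ ω, ‖u ω‖ₑ ^ 2 ∂μ ≤ ENNReal.ofReal C) : MemLp u 2 μ := by
  refine ⟨hu, ?_⟩
  rw [eLpNorm_lt_top_iff_lintegral_rpow_enorm_lt_top two_ne_zero ENNReal.ofNat_ne_top]
  simpa using hC.trans_lt ENNReal.ofReal_lt_top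

lemma integral_sq_norm_le_of_lintegral_sq_le {C : ℝ} (hu : AEStronglyMeasurable u μ) (hC0 : 0 ≤ C)
    (hC : ∫⁻ ω, ‖u ω‖ₑ ^ 2 ∂μ ≤ ENNReal.ofReal C) : ∫ ω, ‖u ω‖ ^ 2 ∂μ ≤ C := by
  rw [integral_eq_lintegral_of_nonneg_ae (.of_forall fun _ => sq_nonneg _) (hu.norm.pow 2)]
  refine ENNReal.toReal_le_of_le_ofReal hC0 ?_
  simpa only [ENNReal.ofReal_pow (norm_nonneg _), ofReal_norm] using hC

lemma memLp_comp_of_lipschitzWith [IsFiniteMeasure μ] {p : ENNReal} {C : NNReal} {Z : V → W}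
    (hZ : LipschitzWith C Z) (hu : MemLp u p μ) : MemLp (fun ω => Z (u ω)) p μ := by
  have hZ0 : LipschitzWith C fun v => Z v - Z 0 := .of_dist_le_mul fun v w => by
    rw [dist_sub_right]
    exact hZ.dist_le_mul v w
  exact ((hZ0.comp_memLp (sub_self _) hu).add (memLp_const (Z 0))).congr_norm
    (hZ.continuous.comp_aestronglyMeasurable hu.1) (.of_forall fun ω => by simp)

end Moments

section Independence

variable {Ω : Type*} [MeasurableSpace Ω] {μ : Measure Ω}

lemma indepFun_of_measurable_comap {α β γ : Type*} [MeasurableSpace α] [MeasurableSpace β]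
    [MeasurableSpace γ] {X : Ω → α} {H : Ω → β} {Y : Ω → γ} (hXH : IndepFun X H μ)
    (hY : Measurable[MeasurableSpace.comap H inferInstance] Y) : IndepFun X Y μ :=
  indep_of_indep_of_le_right hXH hY.comap_le

section Fubini

variable {α β : Type*} [MeasurableSpace α] [MeasurableSpace β] {X : Ω → α} {Y : Ω → β}
  [IsFiniteMeasure μ]

lemma lintegral_comp_of_indepFun (hX : Measurable X) (hY : Measurable Y) (hXY : IndepFun X Y μ)
    {γ : α × β → ENNReal} (hγ : Measurable γ) :
    ∫⁻ ω, γ (X ω, Y ω) ∂μ = ∫⁻ ω, ∫⁻ t, γ (X ω, t) ∂μ.map Y ∂μ := by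
  rw [← lintegral_map hγ (hX.prodMk hY),
    hXY.map_prod_eq_prod_map_map hX.aemeasurable hY.aemeasurable,
    lintegral_prod _ hγ.aemeasurable, lintegral_map hγ.lintegral_prod_right' hX]

variable {V : Type*} [NormedAddCommGroup V]

lemma lintegral_enorm_sq_le_of_indepFun [MeasurableSpace V] [BorelSpace V] (hX : Measurable X)
    (hY : Measurable Y) (hXY : IndepFun X Y μ) {g : α → β → V}
    (hg : Measurable (Function.uncurry g)) {C : ENNReal}
    (hC : ∀ ω, ∫⁻ t, ‖g (X ω) t‖ₑ ^ 2 ∂μ.map Y ≤ C) :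
    ∫⁻ ω, ‖g (X ω) (Y ω)‖ₑ ^ 2 ∂μ ≤ C * μ Set.univ :=
  (lintegral_comp_of_indepFun hX hY hXY (hg.enorm.pow_const 2)).trans_le <|
    (lintegral_mono hC).trans_eq (lintegral_const C)

lemma integrable_integral_comp_of_indepFun [NormedSpace ℝ V] (hX : Measurable X) (hY : Measurable Y)
    (hXY : IndepFun X Y μ) {γ : α × β → V} (hγ : StronglyMeasurable γ)
    (hint : Integrable (fun ω => γ (X ω, Y ω)) μ) :
    Integrable (fun ω => ∫ t, γ (X ω, t) ∂μ.map Y) μ ∧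
      ∫ ω, γ (X ω, Y ω) ∂μ = ∫ ω, ∫ t, γ (X ω, t) ∂μ.map Y ∂μ := by
  have hmap := hXY.map_prod_eq_prod_map_map hX.aemeasurable hY.aemeasurable
  have hmeas : AEStronglyMeasurable (fun z => ∫ t, γ (z, t) ∂μ.map Y) (μ.map X) :=
    hγ.integral_prod_right'.aestronglyMeasurable
  have hprod : Integrable γ ((μ.map X).prod (μ.map Y)) := by
    rw [← hmap, integrable_map_measure hγ.aestronglyMeasurable (hX.prodMk hY).aemeasurable]
    exact hint
  refine ⟨(integrable_map_measure hmeas hX.aemeasurable).1 hprod.integral_prod_left, ?_⟩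
  rw [← integral_map hX.aemeasurable hmeas, ← integral_prod _ hprod, ← hmap,
    integral_map (hX.prodMk hY).aemeasurable hγ.aestronglyMeasurable]

lemma integral_inner_mean_sub_eq_zero [InnerProductSpace ℝ V] [CompleteSpace V]
    [MeasurableSpace V] [BorelSpace V] [SecondCountableTopology V]
    (hX : Measurable X) (hY : Measurable Y) (hXY : IndepFun X Y μ) {u : α → V} {g : α → β → V}
    (hu : Measurable u) (hg : Measurable (Function.uncurry g))
    (hgX : ∀ ω, Integrable (g (X ω)) (μ.map Y)) (huL : MemLp (fun ω => u (X ω)) 2 μ)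
    (hgL : MemLp (fun ω => g (X ω) (Y ω)) 2 μ) :
    Integrable (fun ω => inner ℝ (u (X ω)) (∫ t, g (X ω) t ∂μ.map Y - g (X ω) (Y ω))) μ ∧
      ∫ ω, inner ℝ (u (X ω)) (∫ t, g (X ω) t ∂μ.map Y - g (X ω) (Y ω)) ∂μ = 0 := by
  have hsample := integrable_inner_of_memLp huL hgL
  have hmeas : Measurable fun q : α × β => (inner ℝ (u q.1) (g q.1 q.2) : ℝ) :=
    (hu.comp measurable_fst).inner hg
  obtain ⟨hmean, heq⟩ :=
    integrable_integral_comp_of_indepFun hX hY hXY hmeas.stronglyMeasurable hsample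
  have hinner : ∀ ω, ∫ t, inner ℝ (u (X ω)) (g (X ω) t) ∂μ.map Y
      = inner ℝ (u (X ω)) (∫ t, g (X ω) t ∂μ.map Y) := fun ω => integral_inner (hgX ω) (u (X ω))
  simp only [hinner] at hmean heq
  simp only [inner_sub_right]
  exact ⟨hmean.sub hsample, by rw [integral_sub hmean hsample, heq, sub_self]⟩

end Fubini

section RandomIndex

variable {N : Ω → ℕ} {s : Finset ℕ}

lemma ae_mem_of_sum_measureReal_eq_one [IsProbabilityMeasure μ] (hN : Measurable N)
    (hs : ∑ j ∈ s, μ.real {ω | N ω = j} = 1) : ∀ᵐ ω ∂μ, N ω ∈ s := by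
  have hpre : μ.real {ω | N ω ∈ s} = 1 :=
    (sum_measureReal_preimage_singleton s fun j _ => hN (measurableSet_singleton j)).symm.trans hs
  refine (mem_ae_iff_prob_eq_one (hN s.measurableSet)).2 ?_
  rwa [measureReal_def, ENNReal.toReal_eq_one_iff] at hpre

lemma integrable_integral_comp_index (hN : Measurable N) (hs : ∀ᵐ ω ∂μ, N ω ∈ s)
    {Y : ℕ → Ω → ℝ} (hY : ∀ j ∈ s, Integrable (Y j) μ) (hind : ∀ j ∈ s, IndepFun N (Y j) μ) :
    Integrable (fun ω => Y (N ω) ω) μ ∧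
      ∫ ω, Y (N ω) ω ∂μ = ∑ j ∈ s, μ.real {ω | N ω = j} * ∫ ω, Y j ω ∂μ := by
  have hfib : ∀ j, MeasurableSet {ω | N ω = j} := fun j => hN (measurableSet_singleton j)
  have hae : (fun ω => Y (N ω) ω) =ᵐ[μ] fun ω => ∑ j ∈ s, {ω | N ω = j}.indicator (Y j) ω := by
    filter_upwards [hs] with ω hω
    simp [Set.indicator_apply, hω]
  have hint : ∀ j ∈ s, Integrable ({ω | N ω = j}.indicator (Y j)) μ := fun j hj =>
    (hY j hj).indicator (hfib j)
  refine ⟨(integrable_finsetSum s hint).congr hae.symm, ?_⟩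
  rw [integral_congr_ae hae, integral_finsetSum s hint]
  refine Finset.sum_congr rfl fun j hj => ?_
  rw [integral_indicator (hfib j)]
  exact Indep.setIntegral_eq_mul (f := id) hN.comap_le (hind j hj) (hY j hj).aemeasurable
    ⟨{j}, measurableSet_singleton j, rfl⟩ aestronglyMeasurable_id

end RandomIndex

end Independence

section Descent

variable {E : Type*} [NormedAddCommGroup E] [InnerProductSpace ℝ E]
  {D : Set E} {F R : E → ℝ} {a b ρ δ M ρbar : ℝ} {x y z y' w g d : E}

lemma mul_mul_le_add_mul_sq {c s t : ℝ} (hδ : 0 < δ) :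
    c * (s * t) ≤ δ / 4 * s ^ 2 + c ^ 2 / δ * t ^ 2 := by
  have hyoung := two_mul_le_add_mul_sq (a := s) (b := c * t) (half_pos hδ)
  rw [mul_pow, inv_div] at hyoung
  linarith [show (2 / δ * (c ^ 2 * t ^ 2) : ℝ) = 2 * (c ^ 2 / δ * t ^ 2) by ring]

lemma sub_sub_inner_le_of_delayed_subgradient (hρ : 0 ≤ ρ) (hδ : 0 < δ) (hwM : ‖w‖ ≤ M)
    (hw : F y' + inner ℝ w (z - y') + -ρ / 2 * ‖z - y'‖ ^ 2 ≤ F z) :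
    F x - F z - inner ℝ (x - z) w ≤ (ρ / 2 + δ / 4) * ‖x - z‖ ^ 2
      + (M * ‖x - y'‖ + (F x - F y') + (ρ / 2 + ρ ^ 2 / δ) * ‖x - y'‖ ^ 2) := by
  have hsplit : inner ℝ (x - z) w = inner ℝ w (x - y') - inner ℝ w (z - y') := by
    rw [← inner_sub_right, real_inner_comm]
    congr 1
    abel
  have hdelay : -(M * ‖x - y'‖) ≤ inner ℝ w (x - y') :=
    neg_le_of_abs_le ((abs_real_inner_le_norm _ _).trans (by gcongr))
  have hdist : ‖z - y'‖ ^ 2 ≤ ‖x - z‖ ^ 2 + ‖x - y'‖ ^ 2 + 2 * (‖x - z‖ * ‖x - y'‖) := by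
    have hnorm : ‖z - y'‖ ≤ ‖x - z‖ + ‖x - y'‖ := by
      rw [norm_sub_rev x z]
      exact norm_sub_le_norm_sub_add_norm_sub z x y'
    exact (pow_le_pow_left₀ (norm_nonneg _) hnorm 2).trans_eq (by ring)
  have hyoung := mul_mul_le_add_mul_sq (c := ρ) (s := ‖x - z‖) (t := ‖x - y'‖) hδ
  have hscaled := mul_le_mul_of_nonneg_left hdist (by positivity : 0 ≤ ρ / 2)
  linarith

/-- The inertial term is absorbed in `‖x - z‖²` by Young's inequality, and `ρbar ≤ 2 * ρ` makes the
remaining coefficient of `‖x - z‖²` negative. -/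
lemma IsProxOn.sq_dist_delayed_step_le
    (h : IsProxOn D (fun y => F y + R y) (1 / ρbar) x z)
    (hF : StrongConvexOn D (-ρ) F) (hR : ConvexOn ℝ D R) (hM : 0 ≤ M)
    (hLip : ∀ y ∈ D, ∀ y' ∈ D, F y - F y' ≤ M * ‖y - y'‖)
    (hρ : 0 < ρ) (hρbar : ρbar ∈ Set.Ioc ρ (2 * ρ)) (ha : 0 < a) (haρ : a ≤ 1 / ρbar) (hb : 0 ≤ b)
    (hx : x ∈ D) (hy : IsProxOn D R a (x - a • g + b • d) y) (hwM : ‖w‖ ≤ M)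
    (hw : F y' + inner ℝ w (z - y') + -ρ / 2 * ‖z - y'‖ ^ 2 ≤ F z) :
    ρbar / 2 * ‖y - z‖ ^ 2 ≤ ρbar / 2 * ‖x - z‖ ^ 2 - a * (ρbar * (ρbar - ρ) / 2 * ‖x - z‖ ^ 2)
      + ρbar / 2 * (2 * b ^ 2 + 2 * (b ^ 2 / a) / (ρbar - ρ)) * ‖d‖ ^ 2
      + ρbar * (a * (1 - a * ρbar)) * (inner ℝ (x - z) (w - g)
        + (M * ‖x - y'‖ + (F x - F y') + (ρ / 2 + ρ ^ 2 / (ρbar - ρ)) * ‖x - y'‖ ^ 2))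
      + 2 * ρbar * a ^ 2 * (‖g‖ ^ 2 + M ^ 2) := by
  obtain ⟨hlt, hle⟩ := hρbar
  have hρbar : 0 < ρbar := hρ.trans hlt
  have hδ : 0 < ρbar - ρ := sub_pos.2 hlt
  have hstep := h.sq_dist_step_le hF hR hM hLip ha (one_div_pos.2 hρbar) haρ hx hy
  have hdelay := sub_sub_inner_le_of_delayed_subgradient (x := x) hρ.le hδ hwM hw
  rw [div_div_eq_mul_div, div_one] at hstep
  set c := 1 - a * ρbar with hc
  have hc0 : 0 ≤ c := sub_nonneg.2 ((le_div_iff₀ hρbar).1 haρ)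
  have hc1 : c ≤ 1 := sub_le_self _ (by positivity)
  have hinertial : c * (b * inner ℝ (x - z) d) ≤ a * (ρbar - ρ) / 4 * ‖x - z‖ ^ 2
      + b ^ 2 / (a * (ρbar - ρ)) * ‖d‖ ^ 2 :=
    calc c * (b * inner ℝ (x - z) d) ≤ c * (b * (‖x - z‖ * ‖d‖)) := by
          gcongr
          exact real_inner_le_norm _ _
      _ ≤ b * (‖x - z‖ * ‖d‖) := mul_le_of_le_one_left (by positivity) hc1
      _ ≤ _ := mul_mul_le_add_mul_sq (by positivity)
  have hcoeff : c ^ 2 - 1 + a * (ρbar - ρ) / 2 + a * c * ρ + 2 * (a * c) * (ρ / 2 + (ρbar - ρ) / 4)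
      ≤ -(a * (ρbar - ρ)) := by
    have hgap : 0 ≤ a * (ρbar * a) * (2 * ρ - ρbar + (ρbar - ρ) / 2) :=
      mul_nonneg (by positivity) (by linarith)
    rw [hc]
    linarith
  have hquad := mul_le_mul_of_nonneg_right hcoeff (sq_nonneg ‖x - z‖)
  have hdelay' := mul_le_mul_of_nonneg_left hdelay (by positivity : 0 ≤ 2 * (a * c))
  rw [inner_sub_right, show 2 * (b ^ 2 / a) / (ρbar - ρ) = 2 * (b ^ 2 / (a * (ρbar - ρ))) by
    rw [mul_div_assoc, div_div]]
  have hscaled : ρbar / 2 * (‖y - z‖ ^ 2) ≤ _ := mul_le_mul_of_nonneg_left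
    (hstep.trans (by linarith : _ ≤ ‖x - z‖ ^ 2 - a * (ρbar - ρ) * ‖x - z‖ ^ 2
      + (2 * b ^ 2 + 2 * (b ^ 2 / (a * (ρbar - ρ)))) * ‖d‖ ^ 2
      + 2 * (a * c) * (inner ℝ (x - z) w - inner ℝ (x - z) g
        + (M * ‖x - y'‖ + (F x - F y') + (ρ / 2 + ρ ^ 2 / (ρbar - ρ)) * ‖x - y'‖ ^ 2))
      + 4 * a ^ 2 * (‖g‖ ^ 2 + M ^ 2))) (by positivity)
  refine hscaled.trans_eq ?_
  ring

end Descent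

section Oracle

variable {n : ℕ} {Ξ : Type*} [MeasurableSpace Ξ] {P : Measure Ξ}
  {f : EuclideanSpace ℝ (Fin n) → Ξ → ℝ} {r : EuclideanSpace ℝ (Fin n) → EReal}
  {G : ℕ → EuclideanSpace ℝ (Fin n) → Ξ → EuclideanSpace ℝ (Fin n)} {M ρ : ℝ} {k : ℕ}
  {x : EuclideanSpace ℝ (Fin n)}

namespace IsUnbiasedOracle

lemma aestronglyMeasurable (hG : IsUnbiasedOracle P f r G) (hk : 1 ≤ k)
    (x : EuclideanSpace ℝ (Fin n)) : AEStronglyMeasurable (G k x) P :=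
  ((hG.measurable k hk).comp measurable_prodMk_left).aestronglyMeasurable

lemma lintegral_sq_le (hG : IsUnbiasedOracle P f r G) (hb : BoundedSubgradients P f r M)
    (hk : 1 ≤ k) (hx : x ∈ dom r) : ∫⁻ s, ‖G k x s‖ₑ ^ 2 ∂P ≤ ENNReal.ofReal (M ^ 2) :=
  hb x hx (G k x) ((hG.measurable k hk).comp measurable_prodMk_left)
    (hG.mem_subdifferential k hk x hx)

lemma memLp (hG : IsUnbiasedOracle P f r G) (hb : BoundedSubgradients P f r M) (hk : 1 ≤ k)
    (hx : x ∈ dom r) : MemLp (G k x) 2 P :=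
  memLp_two_of_lintegral_sq_le (hG.aestronglyMeasurable hk x) (hG.lintegral_sq_le hb hk hx)

variable [IsProbabilityMeasure P]

lemma norm_mean_le (hG : IsUnbiasedOracle P f r G) (hM : 0 ≤ M) (hb : BoundedSubgradients P f r M)
    (hk : 1 ≤ k) (hx : x ∈ dom r) : ‖∫ s, G k x s ∂P‖ ≤ M :=
  calc ‖∫ s, G k x s ∂P‖ ≤ ∫ s, ‖G k x s‖ ∂P := norm_integral_le_integral_norm _
    _ ≤ √(∫ s, ‖G k x s‖ ^ 2 ∂P) := integral_norm_le_sqrt (hG.memLp hb hk hx)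
    _ ≤ √(M ^ 2) := Real.sqrt_le_sqrt <| integral_sq_norm_le_of_lintegral_sq_le
        (hG.aestronglyMeasurable hk x) (sq_nonneg M) (hG.lintegral_sq_le hb hk hx)
    _ = M := Real.sqrt_sq hM

lemma expectedLoss_sub_le (hG : IsUnbiasedOracle P f r G) (hM : 0 ≤ M)
    (hb : BoundedSubgradients P f r M) (hF : WeaklyConvex ρ (expectedLoss P f))
    (hr : Convex ℝ (dom r)) :
    ∀ y ∈ dom r, ∀ y' ∈ dom r,
      expectedLoss P f y - expectedLoss P f y' ≤ M * ‖y - y'‖ :=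
  lipschitz_of_sub_le_add_sq hr fun y hy _ hy' =>
    sub_le_mul_norm_of_subgradient_le (hF.strongConvexOn hr) hy hy'
      (hG.unbiased 1 le_rfl y hy) (hG.norm_mean_le hM hb le_rfl hy)

end IsUnbiasedOracle

end Oracle

section StepLength

variable {E : Type*} [NormedAddCommGroup E] [InnerProductSpace ℝ E] {D : Set E} {F R : E → ℝ}
  {a b β L e : ℝ} {x y g d : E}

lemma IsProxOn.sq_norm_step_le_of_sub_le (hR : ConvexOn ℝ D R) (ha : 0 < a) (hb : b ∈ Set.Icc 0 β)
    (hx : x ∈ D) (hy : IsProxOn D R a (x - a • g + b • d) y)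
    (hsub : R x - R y ≤ L * ‖y - x‖ + e) :
    ‖y - x‖ ^ 2 ≤ (β * ‖d‖ + a * (‖g‖ + L)) * ‖y - x‖ + a * e := by
  have hbd : b * ‖d‖ * ‖y - x‖ ≤ β * ‖d‖ * ‖y - x‖ := by
    gcongr
    exact hb.2
  linarith [hy.sq_norm_step_le hR ha hb.1 hx, mul_le_mul_of_nonneg_left hsub ha.le]

lemma IsProxOn.half_sq_norm_step_le_of_lipschitz_loss (hR : ConvexOn ℝ D R)
    (hLip : ∀ y ∈ D, ∀ y' ∈ D, F y - F y' ≤ L * ‖y - y'‖) (ha : 0 < a) (hb : b ∈ Set.Icc 0 β)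
    (hβ : β < 1) (hx : x ∈ D) (hy : IsProxOn D R a (x - a • g + b • d) y) :
    ‖y - x‖ ^ 2 / 2 ≤ β / 2 * ‖d‖ ^ 2 + a ^ 2 * (‖g‖ ^ 2 + L ^ 2) / (1 - β)
      + a * ((F x + R x) - (F y + R y)) := by
  have hstep := hy.sq_norm_step_le_of_sub_le hR ha hb hx
    (e := (F x + R x) - (F y + R y)) (L := L) (by linarith [hLip y hy.1 x hx])
  have hhalf := half_sq_le_of_sq_le_mul_add (hb.1.trans hb.2) hβ hstep
  have hsq : (a * (‖g‖ + L)) ^ 2 / (2 * (1 - β)) ≤ a ^ 2 * (‖g‖ ^ 2 + L ^ 2) / (1 - β) := by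
    rw [← div_div]
    exact div_le_div_of_nonneg_right (by linarith [sq_mul_add_le_two_mul a ‖g‖ L])
      (sub_pos.2 hβ).le
  linarith

lemma IsProxOn.sq_norm_step_le_of_lipschitz (hR : ConvexOn ℝ D R) (hL : 0 ≤ L)
    (hLip : ∀ y ∈ D, ∀ y' ∈ D, R y - R y' ≤ L * ‖y - y'‖) (ha : 0 < a) (hb : b ∈ Set.Icc 0 β)
    (hβ : β < 1) (hx : x ∈ D) (hy : IsProxOn D R a (x - a • g + b • d) y) :
    ‖y - x‖ ^ 2 ≤ (1 + β ^ 2) / 2 * ‖d‖ ^ 2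
      + 2 * (1 + β ^ 2) / (1 - β ^ 2) * (a ^ 2 * (‖g‖ ^ 2 + L ^ 2)) := by
  have hβ0 : 0 ≤ β := hb.1.trans hb.2
  have hβ2 : β ^ 2 < 1 := pow_lt_one₀ hβ0 hβ two_ne_zero
  have : 0 ≤ (1 + β ^ 2) / (1 - β ^ 2) := div_nonneg (by positivity) (sub_pos.2 hβ2).le
  have hnorm : ‖y - x‖ ≤ β * ‖d‖ + a * (‖g‖ + L) := by
    have hstep := hy.sq_norm_step_le_of_sub_le hR ha hb hx (e := 0)
      (by simpa only [add_zero, norm_sub_rev] using hLip x hx y hy.1)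
    rcases (norm_nonneg (y - x)).eq_or_lt with hzero | hpos
    · rw [← hzero]
      positivity
    · exact le_of_mul_le_mul_right (by linarith) hpos
  calc ‖y - x‖ ^ 2 ≤ (β * ‖d‖ + a * (‖g‖ + L)) ^ 2 := pow_le_pow_left₀ (norm_nonneg _) hnorm 2
    _ ≤ (1 + β ^ 2) / 2 * ‖d‖ ^ 2 + (1 + β ^ 2) / (1 - β ^ 2) * (a * (‖g‖ + L)) ^ 2 :=
        sq_mul_add_le hβ2
    _ ≤ (1 + β ^ 2) / 2 * ‖d‖ ^ 2
        + (1 + β ^ 2) / (1 - β ^ 2) * (2 * (a ^ 2 * (‖g‖ ^ 2 + L ^ 2))) := by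
        gcongr
        exact sq_mul_add_le_two_mul a ‖g‖ L
    _ = _ := by ring

end StepLength

section Sequences

variable {a c e d W : ℕ → ℝ} {B C S M κ : ℝ} {k₀ K : ℕ}

/-- Summation by parts: the total variation of the weights `c` is at most `a k₀`. -/
lemma sum_mul_sub_le_of_abs_sub_le (hK : k₀ ≤ K) (hca : ∀ k, k₀ ≤ k → |c k| ≤ a k)
    (hvar : ∀ k, k₀ ≤ k → |c (k + 1) - c k| ≤ a k - a (k + 1)) (hW : ∀ k, |W k| ≤ B) :
    ∑ k ∈ Finset.Icc k₀ K, c k * (W (k + 1) - W k) ≤ 2 * B * a k₀ := by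
  have hprod : ∀ {s t : ℝ} {k}, |s| ≤ t → s * W k ≤ t * B := fun hst =>
    (le_abs_self _).trans <| (abs_mul _ _).trans_le <|
      mul_le_mul hst (hW _) (abs_nonneg _) ((abs_nonneg _).trans hst)
  have hpartial : ∑ k ∈ Finset.Icc k₀ K, c k * (W (k + 1) - W k)
      ≤ c K * W (K + 1) + (2 * a k₀ - a K) * B := by
    induction K, hK using Nat.le_induction with
    | base =>
      have hfirst := hprod (k := k₀) ((abs_neg _).trans_le (hca k₀ le_rfl))
      simp only [Finset.Icc_self, Finset.sum_singleton]
      linarith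
    | succ K hK ih =>
      have hjump := hprod (k := K + 1) ((abs_sub_comm _ _).trans_le (hvar K hK))
      rw [Finset.sum_Icc_succ_top (hK.trans K.le_succ)]
      linarith
  linarith [hprod (k := K + 1) (hca K hK)]

/-- The `j`-step increments of `e` are the one-step increments of its moving sums of length `j`. -/
lemma sum_mul_delay_sub_le (hK : k₀ ≤ K) (hca : ∀ k, k₀ ≤ k → |c k| ≤ a k)
    (hvar : ∀ k, k₀ ≤ k → |c (k + 1) - c k| ≤ a k - a (k + 1)) (he : ∀ k, |e k| ≤ C) (j : ℕ) :
    ∑ k ∈ Finset.Icc k₀ K, c k * (e k - e (k - j)) ≤ 2 * (j * C) * a k₀ := by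
  have hmoving : ∀ k, |∑ i ∈ Finset.range j, e (k - 1 - i)| ≤ j * C := fun k => by
    refine (Finset.abs_sum_le_sum_abs _ _).trans ?_
    exact (Finset.sum_le_card_nsmul _ _ C fun i _ => he _).trans_eq (by simp)
  refine (Finset.sum_congr rfl fun k _ => ?_).trans_le
    (sum_mul_sub_le_of_abs_sub_le hK hca hvar hmoving)
  have hindex : ∀ i, k - 1 - i = k - (i + 1) := fun i => by omega
  simp only [Nat.add_sub_cancel, hindex]
  rw [← Finset.sum_sub_distrib, Finset.sum_range_sub' (fun i => e (k - i)) j, Nat.sub_zero]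

lemma sum_range_sub_le_sum_range (hd0 : d 0 = 0) (hd : ∀ k, 0 ≤ d k) (i K : ℕ) :
    ∑ k ∈ Finset.range (K + 1), d (k - i) ≤ ∑ k ∈ Finset.range (K + 1), d k := by
  induction i with
  | zero => simp
  | succ i ih =>
    refine le_trans ?_ ih
    rw [Finset.sum_range_succ' (fun k => d (k - (i + 1))), Finset.sum_range_succ]
    simp only [Nat.zero_sub, hd0, add_zero, Nat.add_sub_add_right]
    exact le_add_of_nonneg_right (hd _)

lemma sum_Icc_le_sum_range (hd : ∀ k, 0 ≤ d k) (k₀ K : ℕ) :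
    ∑ k ∈ Finset.Icc k₀ K, d k ≤ ∑ k ∈ Finset.range (K + 1), d k :=
  Finset.sum_le_sum_of_subset_of_nonneg
    (fun _ hk => Finset.mem_range_succ_iff.2 (Finset.mem_Icc.1 hk).2) fun k _ _ => hd k

lemma sum_mul_sum_range_sub_le (hd0 : d 0 = 0) (hd : ∀ k, 0 ≤ d k) (k₀ K j : ℕ) :
    ∑ k ∈ Finset.Icc k₀ K, j * ∑ i ∈ Finset.range j, d (k - i)
      ≤ (j : ℝ) ^ 2 * ∑ k ∈ Finset.range (K + 1), d k :=
  calc ∑ k ∈ Finset.Icc k₀ K, j * ∑ i ∈ Finset.range j, d (k - i)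
      = j * ∑ i ∈ Finset.range j, ∑ k ∈ Finset.Icc k₀ K, d (k - i) := by
        rw [← Finset.mul_sum, Finset.sum_comm]
    _ ≤ j * ∑ i ∈ Finset.range j, ∑ k ∈ Finset.range (K + 1), d k := by
        gcongr with i
        exact (sum_Icc_le_sum_range (d := fun k => d (k - i)) (fun k => hd _) k₀ K).trans
          (sum_range_sub_le_sum_range hd0 hd i K)
    _ = (j : ℝ) ^ 2 * ∑ k ∈ Finset.range (K + 1), d k := by
        rw [Finset.sum_const, Finset.card_range, nsmul_eq_mul]
        ring

/-- `q k j` plays the role of `𝔼 ‖x_k - x_{k-j}‖²` and `e k` that of `𝔼 F(x_k)`. -/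
lemma sum_mul_delay_error_le {q : ℕ → ℕ → ℝ} {j J : ℕ} (hK : k₀ ≤ K) (hjJ : j ≤ J)
    (hc0 : ∀ k, k₀ ≤ k → 0 ≤ c k) (hca : ∀ k, k₀ ≤ k → c k ≤ a k)
    (hvar : ∀ k, k₀ ≤ k → |c (k + 1) - c k| ≤ a k - a (k + 1)) (he : ∀ k, |e k| ≤ C)
    (hd0 : d 0 = 0) (hd : ∀ k, 0 ≤ d k) (hS : ∑ k ∈ Finset.range (K + 1), d k ≤ S)
    (hq0 : ∀ k, 0 ≤ q k j) (hq : ∀ k, q k j ≤ j * ∑ i ∈ Finset.range j, d (k - i))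
    (hM : 0 ≤ M) (hκ : 0 ≤ κ) :
    ∑ k ∈ Finset.Icc k₀ K, c k * (M * √(q k j) + (e k - e (k - j)) + κ * q k j)
      ≤ M * (√(∑ k ∈ Finset.Icc k₀ K, a k ^ 2) * (J * √S)) + 2 * (J * C) * a k₀
        + κ * a k₀ * (J ^ 2 * S) := by
  have hC : 0 ≤ C := (abs_nonneg _).trans (he 0)
  have hcabs : ∀ k, k₀ ≤ k → |c k| ≤ a k := fun k hk =>
    (abs_of_nonneg (hc0 k hk)).trans_le (hca k hk)
  have hanti : ∀ k, k₀ ≤ k → a k ≤ a k₀ := fun k hk => by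
    induction k, hk using Nat.le_induction with
    | base => rfl
    | succ k hk ih => exact (sub_nonneg.1 ((abs_nonneg _).trans (hvar k hk))).trans ih
  have hqS : ∑ k ∈ Finset.Icc k₀ K, q k j ≤ J ^ 2 * S := by
    refine (Finset.sum_le_sum fun k _ => hq k).trans <|
      (sum_mul_sum_range_sub_le hd0 hd k₀ K j).trans ?_
    gcongr
    exact Finset.sum_nonneg fun k _ => hd k
  have ha0 : 0 ≤ a k₀ := (hc0 k₀ le_rfl).trans (hca k₀ le_rfl)
  have hnorm : ∑ k ∈ Finset.Icc k₀ K, c k * √(q k j)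
      ≤ √(∑ k ∈ Finset.Icc k₀ K, a k ^ 2) * (J * √S) :=
    calc ∑ k ∈ Finset.Icc k₀ K, c k * √(q k j) ≤ ∑ k ∈ Finset.Icc k₀ K, a k * √(q k j) := by
          gcongr with k hk
          exact hca k (Finset.mem_Icc.1 hk).1
      _ ≤ √(∑ k ∈ Finset.Icc k₀ K, a k ^ 2) * √(∑ k ∈ Finset.Icc k₀ K, √(q k j) ^ 2) :=
          Real.sum_mul_le_sqrt_mul_sqrt _ _ _
      _ ≤ √(∑ k ∈ Finset.Icc k₀ K, a k ^ 2) * (J * √S) := by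
          simp only [Real.sq_sqrt (hq0 _)]
          gcongr
          exact (Real.sqrt_le_sqrt hqS).trans_eq (by
            rw [Real.sqrt_mul (sq_nonneg _), Real.sqrt_sq J.cast_nonneg])
  have hloss : ∑ k ∈ Finset.Icc k₀ K, c k * (e k - e (k - j)) ≤ 2 * (J * C) * a k₀ :=
    (sum_mul_delay_sub_le hK hcabs hvar he j).trans (by gcongr)
  have hsq : ∑ k ∈ Finset.Icc k₀ K, c k * q k j ≤ a k₀ * (J ^ 2 * S) :=
    calc ∑ k ∈ Finset.Icc k₀ K, c k * q k j ≤ ∑ k ∈ Finset.Icc k₀ K, a k₀ * q k j := by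
          gcongr with k hk
          · exact hq0 k
          · exact (hca k (Finset.mem_Icc.1 hk).1).trans (hanti k (Finset.mem_Icc.1 hk).1)
      _ ≤ a k₀ * (J ^ 2 * S) := by
          rw [← Finset.mul_sum]
          gcongr
  have hsplit : ∀ k, c k * (M * √(q k j) + (e k - e (k - j)) + κ * q k j)
      = M * (c k * √(q k j)) + c k * (e k - e (k - j)) + κ * (c k * q k j) := fun k => by ring
  simp only [hsplit, Finset.sum_add_distrib, ← Finset.mul_sum, mul_assoc κ]
  gcongr

lemma sum_mul_sum_mul_le {ι ι' : Type*} {s : Finset ι} {t : Finset ι'} {c : ι → ℝ}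
    {p : ι' → ℝ} {y : ι → ι' → ℝ} {Y : ℝ} (hp : ∀ j ∈ t, 0 ≤ p j) (hp1 : ∑ j ∈ t, p j = 1)
    (h : ∀ j ∈ t, ∑ k ∈ s, c k * y k j ≤ Y) :
    ∑ k ∈ s, c k * ∑ j ∈ t, p j * y k j ≤ Y :=
  calc ∑ k ∈ s, c k * ∑ j ∈ t, p j * y k j = ∑ j ∈ t, p j * ∑ k ∈ s, c k * y k j := by
        simp only [Finset.mul_sum]
        rw [Finset.sum_comm]
        exact Finset.sum_congr rfl fun j _ => Finset.sum_congr rfl fun k _ => by ring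
    _ ≤ ∑ j ∈ t, p j * Y :=
        Finset.sum_le_sum fun j hj => mul_le_mul_of_nonneg_left (h j hj) (hp j hj)
    _ = Y := by rw [← Finset.sum_mul, hp1, one_mul]

end Sequences

section StepSizes

variable {a b : ℕ → ℝ} {α β βt ρbar : ℝ} {k k₀ K l : ℕ}

lemma one_div_add_one_le_log_sub_log (hk : 1 ≤ k) :
    1 / ((k : ℝ) + 1) ≤ Real.log ((k : ℝ) + 1) - Real.log k := by
  have hk' : (0 : ℝ) < k := by exact_mod_cast hk
  have hlog := Real.one_sub_inv_le_log_of_pos (x := ((k : ℝ) + 1) / k) (by positivity)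
  rw [Real.log_div (by positivity) hk'.ne', inv_div] at hlog
  refine le_trans (le_of_eq ?_) hlog
  field_simp
  ring

lemma sum_one_div_le_log (hk₀ : 1 ≤ k₀) (hK : k₀ ≤ K) :
    ∑ k ∈ Finset.Icc k₀ K, 1 / (k : ℝ) ≤ 1 + Real.log K - Real.log k₀ := by
  induction K, hK using Nat.le_induction with
  | base =>
    rw [Finset.Icc_self, Finset.sum_singleton, add_sub_cancel_right, one_div]
    exact inv_le_one_of_one_le₀ (by exact_mod_cast hk₀)
  | succ K hK ih =>
    have hstep := one_div_add_one_le_log_sub_log (hk₀.trans hK)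
    rw [Finset.sum_Icc_succ_top (hK.trans K.le_succ)]
    push_cast
    linarith

lemma two_mul_sqrt_sub_sqrt_le (hk : 1 ≤ k) :
    2 * (√((k : ℝ) + 1) - √(k : ℝ)) ≤ 1 / √(k : ℝ) := by
  have hk' : (0 : ℝ) < k := by exact_mod_cast hk
  rw [le_div_iff₀ (Real.sqrt_pos.2 hk')]
  have hsq := Real.sq_sqrt hk'.le
  have hsq' := Real.sq_sqrt (by positivity : (0 : ℝ) ≤ (k : ℝ) + 1)
  linarith [sq_nonneg (√((k : ℝ) + 1) - √(k : ℝ))]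

lemma two_mul_sqrt_sub_sqrt_le_sum (hk₀ : 1 ≤ k₀) (hK : k₀ ≤ K) :
    2 * (√((K : ℝ) + 1) - √(k₀ : ℝ)) ≤ ∑ k ∈ Finset.Icc k₀ K, 1 / √(k : ℝ) := by
  induction K, hK using Nat.le_induction with
  | base => simpa using two_mul_sqrt_sub_sqrt_le hk₀
  | succ K hK ih =>
    have hstep := two_mul_sqrt_sub_sqrt_le (K.succ_pos)
    rw [Finset.sum_Icc_succ_top (hK.trans K.le_succ)]
    push_cast at hstep ⊢
    linarith

lemma stepSize_pos (hα : 0 < α) (ha : ∀ k, 1 ≤ k → a k = α / √(k : ℝ)) (hk : 1 ≤ k) :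
    0 < a k := by
  rw [ha k hk]
  have : (0 : ℝ) < k := by exact_mod_cast hk
  positivity

lemma stepSize_antitone (hα : 0 < α) (ha : ∀ k, 1 ≤ k → a k = α / √(k : ℝ)) (hk : 1 ≤ k)
    (hkl : k ≤ l) : a l ≤ a k := by
  rw [ha k hk, ha l (hk.trans hkl)]
  have : (0 : ℝ) < k := by exact_mod_cast hk
  gcongr

lemma stepSize_le (hα : 0 < α) (ha : ∀ k, 1 ≤ k → a k = α / √(k : ℝ)) (hk : 1 ≤ k) : a k ≤ α :=
  (stepSize_antitone hα ha le_rfl hk).trans_eq (by simp [ha 1 le_rfl])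

lemma sum_stepSize_sq_le (ha : ∀ k, 1 ≤ k → a k = α / √(k : ℝ)) (hk₀ : 1 ≤ k₀) (hK : k₀ ≤ K) :
    ∑ k ∈ Finset.Icc k₀ K, a k ^ 2 ≤ α ^ 2 * (1 + Real.log K - Real.log k₀) :=
  calc ∑ k ∈ Finset.Icc k₀ K, a k ^ 2 = ∑ k ∈ Finset.Icc k₀ K, α ^ 2 * (1 / (k : ℝ)) := by
        refine Finset.sum_congr rfl fun k hk => ?_
        rw [ha k (hk₀.trans (Finset.mem_Icc.1 hk).1), div_pow, Real.sq_sqrt k.cast_nonneg]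
        ring
    _ ≤ _ := by
        rw [← Finset.mul_sum]
        exact mul_le_mul_of_nonneg_left (sum_one_div_le_log hk₀ hK) (sq_nonneg α)

lemma two_mul_sqrt_sub_sqrt_le_sum_stepSize (hα : 0 < α)
    (ha : ∀ k, 1 ≤ k → a k = α / √(k : ℝ)) (hk₀ : 1 ≤ k₀) (hK : k₀ ≤ K) :
    2 * α * (√((K : ℝ) + 1) - √(k₀ : ℝ)) ≤ ∑ k ∈ Finset.Icc k₀ K, a k :=
  calc 2 * α * (√((K : ℝ) + 1) - √(k₀ : ℝ)) = α * (2 * (√((K : ℝ) + 1) - √(k₀ : ℝ))) := by ring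
    _ ≤ α * ∑ k ∈ Finset.Icc k₀ K, 1 / √(k : ℝ) :=
        mul_le_mul_of_nonneg_left (two_mul_sqrt_sub_sqrt_le_sum hk₀ hK) hα.le
    _ = ∑ k ∈ Finset.Icc k₀ K, a k := by
        rw [Finset.mul_sum]
        refine Finset.sum_congr rfl fun k hk => ?_
        rw [ha k (hk₀.trans (Finset.mem_Icc.1 hk).1), mul_one_div]

lemma abs_mul_one_sub_mul_sub_le {s t : ℝ} (ht : 0 ≤ t) (hts : t ≤ s) (hρ : 0 ≤ ρbar)
    (hs : s * ρbar ≤ 1) : |t * (1 - t * ρbar) - s * (1 - s * ρbar)| ≤ s - t := by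
  have hfactor : t * (1 - t * ρbar) - s * (1 - s * ρbar) = -((s - t) * (1 - (s + t) * ρbar)) := by
    ring
  rw [hfactor, abs_neg, abs_mul, abs_of_nonneg (sub_nonneg.2 hts)]
  refine mul_le_of_le_one_right (sub_nonneg.2 hts) (abs_le.2 ⟨?_, ?_⟩)
  · linarith [mul_le_mul_of_nonneg_right hts hρ]
  · linarith [mul_nonneg (add_nonneg (ht.trans hts) ht) hρ]

lemma inertia_mem_Icc (hβt : 0 ≤ βt) (hβ : 0 ≤ β)
    (hb : ∀ k, 1 ≤ k → b k = min βt (β / (k : ℝ) ^ (1 / 4 : ℝ))) (hk : 1 ≤ k) :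
    b k ∈ Set.Icc 0 βt := by
  rw [hb k hk]
  exact ⟨le_min hβt (by positivity), min_le_left _ _⟩

lemma inertia_sq_div_stepSize_le (hα : 0 < α) (ha : ∀ k, 1 ≤ k → a k = α / √(k : ℝ))
    (hβt : 0 ≤ βt) (hβ : 0 ≤ β)
    (hb : ∀ k, 1 ≤ k → b k = min βt (β / (k : ℝ) ^ (1 / 4 : ℝ))) (hk : 1 ≤ k) :
    b k ^ 2 / a k ≤ β ^ 2 / α := by
  have hk' : (0 : ℝ) < k := by exact_mod_cast hk
  have hroot : ((k : ℝ) ^ (1 / 4 : ℝ)) ^ 2 = √(k : ℝ) := by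
    rw [← Real.rpow_natCast, ← Real.rpow_mul hk'.le, Real.sqrt_eq_rpow]
    norm_num
  have hsq : b k ^ 2 ≤ β ^ 2 / √(k : ℝ) := by
    rw [← hroot, ← div_pow]
    exact pow_le_pow_left₀ (inertia_mem_Icc hβt hβ hb hk).1
      ((hb k hk).trans_le (min_le_right _ _)) 2
  rw [div_le_iff₀ (stepSize_pos hα ha hk), ha k hk, div_mul_div_cancel₀ hα.ne']
  exact hsq

end StepSizes

section Recursion

variable {a d w : ℕ → ℝ} {α p q B C : ℝ} {K : ℕ}

lemma sum_range_eq_sum_Icc_succ (h0 : d 0 = 0) (h1 : d 1 = 0) (K : ℕ) :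
    ∑ k ∈ Finset.range (K + 2), d k = ∑ k ∈ Finset.Icc 1 K, d (k + 1) := by
  induction K with
  | zero => simp [Finset.sum_range_succ, h0, h1]
  | succ K ih => rw [Finset.sum_range_succ, ih, Finset.sum_Icc_succ_top (by omega)]

lemma sum_range_le_of_recursion (hα : 0 < α) (ha : ∀ k, 1 ≤ k → a k = α / √(k : ℝ)) (hK : 1 ≤ K)
    (h0 : d 0 = 0) (h1 : d 1 = 0) (hd : ∀ k, 0 ≤ d k) (hq : 0 ≤ q) (hqp : q < p) (hC : 0 ≤ C)
    (hw : ∀ k, |w k| ≤ B)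
    (h : ∀ k, 1 ≤ k → p * d (k + 1) ≤ q * d k + C * a k ^ 2 + a k * (w k - w (k + 1))) :
    ∑ k ∈ Finset.range (K + 1), d k
      ≤ (2 * B * α + C * (α ^ 2 * (1 + Real.log K))) / (p - q) := by
  have hB : 0 ≤ B := (abs_nonneg _).trans (hw 0)
  have habel : ∑ k ∈ Finset.Icc 1 K, a k * (w k - w (k + 1)) ≤ 2 * B * α := by
    refine le_trans ?_ (mul_le_mul_of_nonneg_left (stepSize_le hα ha le_rfl) (by positivity))
    have hmono (k : ℕ) (hk : 1 ≤ k) := stepSize_antitone hα ha hk (Nat.le_succ k)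
    simpa [neg_add_eq_sub] using sum_mul_sub_le_of_abs_sub_le (a := a) (c := a) (W := fun k => -w k)
      hK (fun k hk => (abs_of_pos (stepSize_pos hα ha hk)).le)
      (fun k hk => (abs_sub_comm _ _).trans_le (abs_of_nonneg (sub_nonneg.2 (hmono k hk))).le)
      (fun k => (abs_neg (w k)).trans_le (hw k))
  have hsq := sum_stepSize_sq_le ha le_rfl hK
  rw [Nat.cast_one, Real.log_one, sub_zero] at hsq
  have hsum := Finset.sum_le_sum (s := Finset.Icc 1 K) fun k hk => h k (Finset.mem_Icc.1 hk).1
  simp only [Finset.sum_add_distrib, ← Finset.mul_sum] at hsum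
  rw [← sum_range_eq_sum_Icc_succ h0 h1, Finset.sum_range_succ] at hsum
  rw [le_div_iff₀ (sub_pos.2 hqp)]
  linarith [mul_le_mul_of_nonneg_left (sum_Icc_le_sum_range hd 1 K) hq,
    mul_le_mul_of_nonneg_left hsq hC, mul_nonneg (hq.trans hqp.le) (hd (K + 1))]

end Recursion

section Past

variable {Ω Ξ : Type*} [MeasurableSpace Ξ] {ξ : ℕ → Ω → Ξ} {τ : ℕ → Ω → ℕ}

/-- The σ-algebra generated by the samples and delays of the iterations `1, …, k - 1`. -/
abbrev past (ξ : ℕ → Ω → Ξ) (τ : ℕ → Ω → ℕ) (k : ℕ) : MeasurableSpace Ω :=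
  MeasurableSpace.comap (history ξ τ k) inferInstance

lemma measurable_past_sample {j k : ℕ} (hj : j ∈ Set.Ico 1 k) : Measurable[past ξ τ k] (ξ j) :=
  ((measurable_pi_apply (⟨j, hj⟩ : Set.Ico 1 k)).comp measurable_fst).comp
    (comap_measurable (history ξ τ k))

lemma measurable_past_delay {j k : ℕ} (hj : j ∈ Set.Ico 1 k) : Measurable[past ξ τ k] (τ j) :=
  ((measurable_pi_apply (⟨j, hj⟩ : Set.Ico 1 k)).comp measurable_snd).comp
    (comap_measurable (history ξ τ k))

lemma measurable_history {_ : MeasurableSpace Ω} {k : ℕ}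
    (hξ : ∀ j ∈ Set.Ico 1 k, Measurable (ξ j)) (hτ : ∀ j ∈ Set.Ico 1 k, Measurable (τ j)) :
    Measurable (history ξ τ k) :=
  (measurable_pi_lambda _ fun j : Set.Ico 1 k => hξ j j.2).prodMk
    (measurable_pi_lambda _ fun j : Set.Ico 1 k => hτ j j.2)

lemma past_mono {j k : ℕ} (hjk : j ≤ k) : past ξ τ j ≤ past ξ τ k :=
  Measurable.comap_le (m₁ := past ξ τ k) <| measurable_history
    (fun _ hi => measurable_past_sample (Set.Ico_subset_Ico_right hjk hi))
    fun _ hi => measurable_past_delay (Set.Ico_subset_Ico_right hjk hi)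

lemma past_le [m : MeasurableSpace Ω] {k : ℕ} (hξ : ∀ j ∈ Set.Ico 1 k, Measurable (ξ j))
    (hτ : ∀ j ∈ Set.Ico 1 k, Measurable (τ j)) : past ξ τ k ≤ m :=
  (measurable_history hξ hτ).comap_le

lemma measurable_comp_index {_ : MeasurableSpace Ω} {N : Ω → ℕ} {Y : ℕ → Ω → Ξ}
    (hN : Measurable N) (hY : ∀ j, Measurable (Y j)) : Measurable fun ω => Y (N ω) ω :=
  (measurable_from_prod_countable_left (f := fun p : Ω × ℕ => Y p.2 p.1) hY).comp
    (measurable_id.prodMk hN)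

end Past

section Iterates

variable {n : ℕ} {Ω Ξ : Type*} {r : EuclideanSpace ℝ (Fin n) → EReal}
  {G : ℕ → EuclideanSpace ℝ (Fin n) → Ξ → EuclideanSpace ℝ (Fin n)}
  {ξ : ℕ → Ω → Ξ} {τ : ℕ → Ω → ℕ} {a b : ℕ → ℝ} {x₀ : EuclideanSpace ℝ (Fin n)}
  {x : ℕ → Ω → EuclideanSpace ℝ (Fin n)}

lemma IsRun.mem_dom (hx : IsRun r G ξ τ a b x₀ x) (hr : ProperClosedConvex r) (k : ℕ) (ω : Ω) :
    x k ω ∈ dom r := by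
  match k with
  | 0 => exact hx.zero ω ▸ hx.init_mem
  | 1 => exact hx.one ω ▸ hx.init_mem
  | k + 2 => exact (hr.isProxOn (hx.step (k + 1) (by omega) ω)).1

lemma ProperClosedConvex.exists_lipschitz_prox (hr : ProperClosedConvex r) {B : ℝ}
    (hB : ∀ y ∈ dom r, B ≤ (r y).toReal) {a : ℝ} (ha : 0 < a) :
    ∃ Z : EuclideanSpace ℝ (Fin n) → EuclideanSpace ℝ (Fin n),
      (∃ L, LipschitzWith L Z) ∧ ∀ y z, IsProx r a y z → z = Z y := by
  choose Z hZ using exists_isProx hr.ne_bot hr.proper hr.closed hB ha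
  have hconv := strongConvexOn_zero.2 hr.convexOn_toReal
  refine ⟨Z, ⟨_, lipschitzWith_of_isProxOn (fun y => hr.isProxOn (hZ y)) hconv ha (by simp)⟩, ?_⟩
  intro y z hz
  have hdist := (hr.isProxOn hz).mul_dist_le (hr.isProxOn (hZ y)) hconv ha
  rw [mul_zero, add_zero, one_mul, sub_self, norm_zero] at hdist
  exact sub_eq_zero.1 (norm_le_zero_iff.1 hdist)

lemma IsRun.measurable_past [MeasurableSpace Ξ] (hx : IsRun r G ξ τ a b x₀ x)
    (hr : ProperClosedConvex r) {B : ℝ} (hB : ∀ y ∈ dom r, B ≤ (r y).toReal)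
    (hG : ∀ k, 1 ≤ k → Measurable (Function.uncurry (G k))) (ha : ∀ k, 1 ≤ k → 0 < a k) (k : ℕ) :
    Measurable[past ξ τ k] (x k) := by
  induction k using Nat.strong_induction_on with
  | _ k ih =>
    match k with
    | 0 => exact funext hx.zero ▸ measurable_const
    | 1 => exact funext hx.one ▸ measurable_const
    | k + 2 =>
      obtain ⟨Z, ⟨L, hZL⟩, hZ⟩ := hr.exists_lipschitz_prox hB (ha (k + 1) (by omega))
      have hearlier (j : ℕ) (hj : j ≤ k + 1) : Measurable[past ξ τ (k + 2)] (x j) :=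
        (ih j (by omega)).mono (past_mono (by omega)) le_rfl
      have hlast : k + 1 ∈ Set.Ico 1 (k + 2) := ⟨by omega, by omega⟩
      have hdelayed := measurable_comp_index (measurable_past_delay (ξ := ξ) (τ := τ) hlast)
        fun j => hearlier (k + 1 - j) (Nat.sub_le _ _)
      have hgrad := (hG (k + 1) (by omega)).comp (hdelayed.prodMk (measurable_past_sample hlast))
      have hcurr := hearlier (k + 1) le_rfl
      rw [funext fun ω => hZ _ _ (hx.step (k + 1) (by omega) ω)]
      exact hZL.continuous.measurable.comp ((hcurr.sub (hgrad.const_smul (a (k + 1)))).add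
        ((hcurr.sub (hearlier k (by omega))).const_smul (b (k + 1))))

end Iterates

section Envelope

variable {n : ℕ} {F : EuclideanSpace ℝ (Fin n) → ℝ} {r : EuclideanSpace ℝ (Fin n) → EReal}
  {Z : EuclideanSpace ℝ (Fin n) → EuclideanSpace ℝ (Fin n)} {ρ lam : ℝ}

lemma ProperClosedConvex.strongConvexOn_objective (hr : ProperClosedConvex r)
    (hF : WeaklyConvex ρ F) : StrongConvexOn (dom r) (-ρ) fun y => F y + (r y).toReal :=
  strongConvexOn_add_convexOn (hF.strongConvexOn hr.convexOn_toReal.1) hr.convexOn_toReal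

lemma exists_isProx_objective (hr : ProperClosedConvex r) (hF : Continuous F)
    (hbdd : ⊥ < ⨅ y, objective F r y) (hlam : 0 < lam) (x : EuclideanSpace ℝ (Fin n)) :
    ∃ z, IsProx (objective F r) lam x z := by
  refine exists_isProx (fun y => objective_ne_bot (hr.ne_bot y)) ?_
    (hr.lowerSemicontinuous_objective hF) (fun y hy => optimalValue_le hbdd hy) hlam x
  rw [dom_objective]
  exact hr.proper

lemma exists_lipschitzWith_prox_objective (hr : ProperClosedConvex r) (hF : WeaklyConvex ρ F)
    (hlam : 0 < lam) (hlamρ : lam * ρ < 1) (hZ : ∀ y, IsProx (objective F r) lam y (Z y)) :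
    ∃ L, LipschitzWith L Z :=
  ⟨_, lipschitzWith_of_isProxOn (fun y => hr.isProxOn_objective (hZ y))
    (hr.strongConvexOn_objective hF) hlam (by linarith)⟩

lemma hasGradientAt_moreauEnvelope (hr : ProperClosedConvex r) (hF : WeaklyConvex ρ F)
    (hlam : 0 < lam) (hlamρ : lam * ρ < 1) (hZ : ∀ y, IsProx (objective F r) lam y (Z y))
    (x : EuclideanSpace ℝ (Fin n)) :
    HasGradientAt (moreauEnvelope (objective F r) lam) (lam⁻¹ • (x - Z x)) x :=
  hasGradientAt_envelope (hr.strongConvexOn_objective hF) hlam (by linarith)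
    (fun y => hr.isProxOn_objective (hZ y)) (fun y => hr.moreauEnvelope_objective_eq (hZ y)) x

lemma differentiable_moreauEnvelope (hr : ProperClosedConvex r) (hF : WeaklyConvex ρ F)
    (hlam : 0 < lam) (hlamρ : lam * ρ < 1) (hZ : ∀ y, IsProx (objective F r) lam y (Z y)) :
    Differentiable ℝ (moreauEnvelope (objective F r) lam) :=
  fun x => (hasGradientAt_moreauEnvelope hr hF hlam hlamρ hZ x).differentiableAt

lemma sq_norm_gradient_moreauEnvelope (hr : ProperClosedConvex r) (hF : WeaklyConvex ρ F)
    (hlam : 0 < lam) (hlamρ : lam * ρ < 1) (hZ : ∀ y, IsProx (objective F r) lam y (Z y))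
    (x : EuclideanSpace ℝ (Fin n)) :
    ‖gradient (moreauEnvelope (objective F r) lam) x‖ ^ 2 = lam⁻¹ ^ 2 * ‖x - Z x‖ ^ 2 := by
  rw [(hasGradientAt_moreauEnvelope hr hF hlam hlamρ hZ x).gradient, norm_smul, mul_pow,
    Real.norm_eq_abs, sq_abs]

lemma moreauEnvelope_objective_le (hr : ProperClosedConvex r)
    (hZ : ∀ y, IsProx (objective F r) lam y (Z y)) (x : EuclideanSpace ℝ (Fin n))
    {y : EuclideanSpace ℝ (Fin n)} (hy : y ∈ dom r) :
    moreauEnvelope (objective F r) lam x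
      ≤ F y + (r y).toReal + 1 / (2 * lam) * ‖y - x‖ ^ 2 := by
  rw [hr.moreauEnvelope_objective_eq (hZ x)]
  exact (hr.isProxOn_objective (hZ x)).2 hy

lemma optimalValue_le_moreauEnvelope (hr : ProperClosedConvex r)
    (hbdd : ⊥ < ⨅ y, objective F r y) (hlam : 0 < lam)
    (hZ : ∀ y, IsProx (objective F r) lam y (Z y)) (x : EuclideanSpace ℝ (Fin n)) :
    optimalValue (objective F r) ≤ moreauEnvelope (objective F r) lam x := by
  rw [hr.moreauEnvelope_objective_eq (hZ x)]
  exact le_add_of_le_of_nonneg (hr.optimalValue_le hbdd (hr.isProxOn_objective (hZ x)).1)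
    (by positivity)

lemma integrable_moreauEnvelope_comp {Ω : Type*} [MeasurableSpace Ω] {μ : Measure Ω}
    [IsFiniteMeasure μ] (hr : ProperClosedConvex r) (hbdd : ⊥ < ⨅ y, objective F r y)
    (hlam : 0 < lam) (hZ : ∀ y, IsProx (objective F r) lam y (Z y))
    (hcont : Continuous (moreauEnvelope (objective F r) lam))
    {u : Ω → EuclideanSpace ℝ (Fin n)} (hu : MemLp u 2 μ) :
    Integrable (fun ω => moreauEnvelope (objective F r) lam (u ω)) μ := by
  obtain ⟨y, hy⟩ := hr.proper
  refine integrable_of_le_of_le (hcont.comp_aestronglyMeasurable hu.1)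
    (.of_forall fun ω => optimalValue_le_moreauEnvelope hr hbdd hlam hZ (u ω))
    (.of_forall fun ω => moreauEnvelope_objective_le hr hZ (u ω) hy) (integrable_const _)
    ((integrable_const _).add (Integrable.const_mul ?_ _))
  exact integrable_sq_norm_of_memLp ((memLp_const y).sub hu)

lemma integrable_comp_of_abs_le {Ω : Type*} [MeasurableSpace Ω] {μ : Measure Ω}
    [IsFiniteMeasure μ] (hF : Continuous F) {C : ℝ} (hC : ∀ y ∈ dom r, |F y| ≤ C)
    {u : Ω → EuclideanSpace ℝ (Fin n)} (hu : Measurable u) (hur : ∀ ω, u ω ∈ dom r) :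
    Integrable (fun ω => F (u ω)) μ :=
  .of_bound (hF.measurable.comp hu).aestronglyMeasurable C (.of_forall fun ω => hC _ (hur ω))

lemma integrable_objective_comp {Ω : Type*} [MeasurableSpace Ω] {μ : Measure Ω}
    [IsFiniteMeasure μ] (hr : ProperClosedConvex r) (hF : Continuous F) {C : ℝ}
    (hC : ∀ y ∈ dom r, |F y + (r y).toReal| ≤ C)
    {u : Ω → EuclideanSpace ℝ (Fin n)} (hu : Measurable u) (hur : ∀ ω, u ω ∈ dom r) :
    Integrable (fun ω => F (u ω) + (r (u ω)).toReal) μ :=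
  .of_bound ((hF.measurable.add hr.closed.measurable.ereal_toReal).comp hu).aestronglyMeasurable C
    (.of_forall fun ω => hC _ (hur ω))

end Envelope

section StochasticRun

/-- The stochastic subgradient `g⁽ᵏ⁾` of iteration `k`. -/
def stochasticSubgradient {Ω Ξ V : Type*} (G : ℕ → V → Ξ → V) (ξ : ℕ → Ω → Ξ) (τ : ℕ → Ω → ℕ)
    (x : ℕ → Ω → V) (k : ℕ) (ω : Ω) : V :=
  G k (x (k - τ k ω) ω) (ξ k ω)

/-- The conditional mean of `g⁽ᵏ⁾` given the earlier samples and the delays up to `τ_k`. -/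
noncomputable def meanSubgradient {Ω Ξ V : Type*} [NormedAddCommGroup V] [NormedSpace ℝ V]
    [MeasurableSpace Ξ] (P : Measure Ξ) (G : ℕ → V → Ξ → V) (τ : ℕ → Ω → ℕ) (x : ℕ → Ω → V)
    (k : ℕ) (ω : Ω) : V :=
  ∫ s, G k (x (k - τ k ω) ω) s ∂P

/-- `𝔼 ‖x⁽ᵏ⁾ - x⁽ᵏ⁻ʲ⁾‖²`, with the convention `x⁽ⁱ⁾ = x⁽⁰⁾` for `i ≤ 0`. -/
noncomputable def meanSqIncrement {Ω V : Type*} [NormedAddCommGroup V] [MeasurableSpace Ω]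
    (μ : Measure Ω) (x : ℕ → Ω → V) (k j : ℕ) : ℝ :=
  ∫ ω, ‖x k ω - x (k - j) ω‖ ^ 2 ∂μ

section MeanSqIncrement

variable {Ω V : Type*} [NormedAddCommGroup V] [MeasurableSpace Ω] {μ : Measure Ω}

lemma meanSqIncrement_zero (x : ℕ → Ω → V) (j : ℕ) : meanSqIncrement μ x 0 j = 0 := by
  simp [meanSqIncrement]

lemma meanSqIncrement_nonneg (x : ℕ → Ω → V) (k j : ℕ) : 0 ≤ meanSqIncrement μ x k j :=
  integral_nonneg fun _ => sq_nonneg _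

end MeanSqIncrement

/-- A run of the method driven by independent samples, with a bounded unbiased oracle. Nothing is
required of the delays beyond measurability and independence of the current sample. -/
structure IsStochasticRun {n : ℕ} {Ω Ξ : Type*} [MeasurableSpace Ω] [MeasurableSpace Ξ]
    (μ : Measure Ω) (P : Measure Ξ) (f : EuclideanSpace ℝ (Fin n) → Ξ → ℝ)
    (r : EuclideanSpace ℝ (Fin n) → EReal)
    (G : ℕ → EuclideanSpace ℝ (Fin n) → Ξ → EuclideanSpace ℝ (Fin n)) (M : ℝ)
    (ξ : ℕ → Ω → Ξ) (τ : ℕ → Ω → ℕ) (a b : ℕ → ℝ) (x₀ : EuclideanSpace ℝ (Fin n))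
    (x : ℕ → Ω → EuclideanSpace ℝ (Fin n)) : Prop where
  convex : ProperClosedConvex r
  bddBelow : ∃ B, ∀ y ∈ dom r, B ≤ (r y).toReal
  oracle : IsUnbiasedOracle P f r G
  nonneg : 0 ≤ M
  bounded : BoundedSubgradients P f r M
  sampling : IsSampling μ P ξ τ
  measurable_delay : ∀ k, 1 ≤ k → Measurable (τ k)
  stepSize_pos : ∀ k, 1 ≤ k → 0 < a k
  run : IsRun r G ξ τ a b x₀ x

namespace IsStochasticRun

variable {n : ℕ} {Ω Ξ : Type*} [MeasurableSpace Ω] [MeasurableSpace Ξ]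
  {μ : Measure Ω} {P : Measure Ξ}
  {f : EuclideanSpace ℝ (Fin n) → Ξ → ℝ} {r : EuclideanSpace ℝ (Fin n) → EReal}
  {G : ℕ → EuclideanSpace ℝ (Fin n) → Ξ → EuclideanSpace ℝ (Fin n)} {M : ℝ}
  {ξ : ℕ → Ω → Ξ} {τ : ℕ → Ω → ℕ} {a b : ℕ → ℝ} {x₀ : EuclideanSpace ℝ (Fin n)}
  {x : ℕ → Ω → EuclideanSpace ℝ (Fin n)} {k : ℕ}

lemma mem_dom (h : IsStochasticRun μ P f r G M ξ τ a b x₀ x) (k : ℕ) (ω : Ω) : x k ω ∈ dom r :=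
  h.run.mem_dom h.convex k ω

lemma measurable_past (h : IsStochasticRun μ P f r G M ξ τ a b x₀ x) {j : ℕ} (hjk : j ≤ k) :
    Measurable[past ξ τ k] (x j) := by
  obtain ⟨B, hB⟩ := h.bddBelow
  exact (h.run.measurable_past h.convex hB h.oracle.measurable h.stepSize_pos j).mono
    (past_mono hjk) le_rfl

lemma measurable_iterate (h : IsStochasticRun μ P f r G M ξ τ a b x₀ x) (k : ℕ) :
    Measurable (x k) :=
  (h.measurable_past le_rfl).mono (past_le (fun j hj => h.sampling.measurable j hj.1)
    fun j hj => h.measurable_delay j hj.1) le_rfl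

lemma measurable_delayed (h : IsStochasticRun μ P f r G M ξ τ a b x₀ x) (hk : 1 ≤ k) :
    Measurable fun ω => (x k ω, x (k - τ k ω) ω) :=
  (h.measurable_iterate k).prodMk
    (measurable_comp_index (Y := fun j => x (k - j)) (h.measurable_delay k hk)
      fun j => h.measurable_iterate (k - j))

lemma indepFun_delayed_sample (h : IsStochasticRun μ P f r G M ξ τ a b x₀ x) (hk : 1 ≤ k) :
    IndepFun (fun ω => (x k ω, x (k - τ k ω) ω)) (ξ k) μ := by
  have hpair : Measurable[MeasurableSpace.comap (fun ω => (history ξ τ k ω, τ k ω)) inferInstance]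
      fun ω => (history ξ τ k ω, τ k ω) := comap_measurable _
  have hiterate (j : ℕ) (hj : j ≤ k) := (h.measurable_past hj).mono
    (measurable_fst.comp hpair).comap_le le_rfl
  exact (indepFun_of_measurable_comap (h.sampling.indep k hk) ((hiterate k le_rfl).prodMk
    (measurable_comp_index (Y := fun j => x (k - j)) (measurable_snd.comp hpair)
      fun j => hiterate (k - j) (Nat.sub_le _ _)))).symm

variable [IsProbabilityMeasure μ]

lemma lintegral_sq_stochasticSubgradient_le (h : IsStochasticRun μ P f r G M ξ τ a b x₀ x)
    (hk : 1 ≤ k) :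
    ∫⁻ ω, ‖stochasticSubgradient G ξ τ x k ω‖ₑ ^ 2 ∂μ ≤ ENNReal.ofReal (M ^ 2) := by
  have hle := lintegral_enorm_sq_le_of_indepFun (C := ENNReal.ofReal (M ^ 2))
    (measurable_snd.comp (h.measurable_delayed hk)) (h.sampling.measurable k hk)
    ((h.indepFun_delayed_sample hk).comp measurable_snd measurable_id)
    (h.oracle.measurable k hk) fun ω => by
      rw [h.sampling.law k hk]
      exact h.oracle.lintegral_sq_le h.bounded hk (h.mem_dom _ ω)
  rw [measure_univ, mul_one] at hle
  exact hle

lemma memLp_stochasticSubgradient (h : IsStochasticRun μ P f r G M ξ τ a b x₀ x) (hk : 1 ≤ k) :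
    MemLp (stochasticSubgradient G ξ τ x k) 2 μ :=
  memLp_two_of_lintegral_sq_le ((h.oracle.measurable k hk).comp
    ((measurable_snd.comp (h.measurable_delayed hk)).prodMk
      (h.sampling.measurable k hk))).aestronglyMeasurable
    (h.lintegral_sq_stochasticSubgradient_le hk)

lemma integral_sq_stochasticSubgradient_le (h : IsStochasticRun μ P f r G M ξ τ a b x₀ x)
    (hk : 1 ≤ k) : ∫ ω, ‖stochasticSubgradient G ξ τ x k ω‖ ^ 2 ∂μ ≤ M ^ 2 :=
  integral_sq_norm_le_of_lintegral_sq_le (h.memLp_stochasticSubgradient hk).1 (sq_nonneg M)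
    (h.lintegral_sq_stochasticSubgradient_le hk)

lemma isProbabilityMeasure_law (h : IsStochasticRun μ P f r G M ξ τ a b x₀ x) :
    IsProbabilityMeasure P :=
  h.sampling.law 1 le_rfl ▸
    Measure.isProbabilityMeasure_map (h.sampling.measurable 1 le_rfl).aemeasurable

lemma integral_inner_mean_sub (h : IsStochasticRun μ P f r G M ξ τ a b x₀ x) (hk : 1 ≤ k)
    {u : EuclideanSpace ℝ (Fin n) → EuclideanSpace ℝ (Fin n)} (hu : Measurable u)
    (huL : MemLp (fun ω => u (x k ω)) 2 μ) :
    Integrable (fun ω => inner ℝ (u (x k ω))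
        (meanSubgradient P G τ x k ω - stochasticSubgradient G ξ τ x k ω)) μ ∧
      ∫ ω, inner ℝ (u (x k ω))
        (meanSubgradient P G τ x k ω - stochasticSubgradient G ξ τ x k ω) ∂μ = 0 := by
  have := h.isProbabilityMeasure_law
  have hmean := integral_inner_mean_sub_eq_zero (μ := μ) (h.measurable_delayed hk)
    (h.sampling.measurable k hk) (h.indepFun_delayed_sample hk)
    (u := fun v => u v.1) (g := fun v s => G k v.2 s) (hu.comp measurable_fst)
    ((h.oracle.measurable k hk).comp
      ((measurable_snd.comp measurable_fst).prodMk measurable_snd))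
  rw [h.sampling.law k hk] at hmean
  exact hmean (fun ω => (h.oracle.memLp h.bounded hk (h.mem_dom _ ω)).integrable one_le_two) huL
    (h.memLp_stochasticSubgradient hk)

lemma memLp_iterate (h : IsStochasticRun μ P f r G M ξ τ a b x₀ x) (k : ℕ) :
    MemLp (x k) 2 μ := by
  induction k using Nat.strong_induction_on with
  | _ k ih =>
    match k with
    | 0 => exact funext h.run.zero ▸ memLp_const x₀
    | 1 => exact funext h.run.one ▸ memLp_const x₀
    | k + 2 =>
      obtain ⟨B, hB⟩ := h.bddBelow
      obtain ⟨Z, ⟨L, hZL⟩, hZ⟩ :=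
        h.convex.exists_lipschitz_prox hB (h.stepSize_pos (k + 1) (by omega))
      rw [funext fun ω => hZ _ _ (h.run.step (k + 1) (by omega) ω)]
      have hcurr := ih (k + 1) (by omega)
      exact memLp_comp_of_lipschitzWith hZL
        ((hcurr.sub ((h.memLp_stochasticSubgradient (by omega)).const_smul (a (k + 1)))).add
          ((hcurr.sub (ih k (by omega))).const_smul (b (k + 1))))

lemma integrable_sq_increment (h : IsStochasticRun μ P f r G M ξ τ a b x₀ x) (k l : ℕ) :
    Integrable (fun ω => ‖x k ω - x l ω‖ ^ 2) μ :=
  integrable_sq_norm_of_memLp ((h.memLp_iterate k).sub (h.memLp_iterate l))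

lemma meanSqIncrement_le (h : IsStochasticRun μ P f r G M ξ τ a b x₀ x) (k j : ℕ) :
    meanSqIncrement μ x k j
      ≤ j * ∑ i ∈ Finset.range j, meanSqIncrement μ x (k - i) 1 := by
  have hint : ∀ i ∈ Finset.range j, Integrable (fun ω => ‖x (k - i) ω - x (k - i - 1) ω‖ ^ 2) μ :=
    fun i _ => h.integrable_sq_increment _ _
  simp only [meanSqIncrement]
  rw [← integral_finsetSum _ hint, ← integral_const_mul]
  refine integral_mono (h.integrable_sq_increment _ _)
    ((integrable_finsetSum _ hint).const_mul _) fun ω => ?_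
  have htelescope : x k ω - x (k - j) ω
      = ∑ i ∈ Finset.range j, (x (k - i) ω - x (k - i - 1) ω) := by
    simp only [Nat.sub_sub]
    rw [Finset.sum_range_sub' (fun i => x (k - i) ω) j, Nat.sub_zero]
  calc ‖x k ω - x (k - j) ω‖ ^ 2
      ≤ (∑ i ∈ Finset.range j, ‖x (k - i) ω - x (k - i - 1) ω‖) ^ 2 := by
        rw [htelescope]
        gcongr
        exact norm_sum_le _ _
    _ ≤ j * ∑ i ∈ Finset.range j, ‖x (k - i) ω - x (k - i - 1) ω‖ ^ 2 := by
        simpa using sq_sum_le_card_mul_sum_sq (s := Finset.range j)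
          (f := fun i => ‖x (k - i) ω - x (k - i - 1) ω‖)

end IsStochasticRun

end StochasticRun

section ExpectedDescent

/-- The error `M ‖x - x'‖ + (F x - F x') + κ ‖x - x'‖²` committed in a descent step of length one at
`x` when the subgradient is evaluated at the outdated point `x'`. -/
def delayError {V : Type*} [NormedAddCommGroup V] (F : V → ℝ) (M κ : ℝ) (x x' : V) : ℝ :=
  M * ‖x - x'‖ + (F x - F x') + κ * ‖x - x'‖ ^ 2

lemma IsStochasticDelay.prob_nonneg {Ω Ξ : Type*} [MeasurableSpace Ω] [MeasurableSpace Ξ]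
    {μ : Measure Ω} {ξ : ℕ → Ω → Ξ} {τ : ℕ → Ω → ℕ} {τmax : ℕ} {p : ℕ → ℝ}
    (hτ : IsStochasticDelay μ ξ τ τmax p) {j : ℕ} (hj : j ∈ Finset.range (τmax + 1)) : 0 ≤ p j :=
  hτ.law 1 le_rfl j (Finset.mem_range_succ_iff.1 hj) ▸ measureReal_nonneg

namespace IsStochasticRun

variable {n : ℕ} {Ω Ξ : Type*} [MeasurableSpace Ω] [MeasurableSpace Ξ]
  {μ : Measure Ω} {P : Measure Ξ}
  {f : EuclideanSpace ℝ (Fin n) → Ξ → ℝ} {r : EuclideanSpace ℝ (Fin n) → EReal}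
  {G : ℕ → EuclideanSpace ℝ (Fin n) → Ξ → EuclideanSpace ℝ (Fin n)} {M : ℝ}
  {ξ : ℕ → Ω → Ξ} {τ : ℕ → Ω → ℕ} {a b : ℕ → ℝ} {x₀ : EuclideanSpace ℝ (Fin n)}
  {x : ℕ → Ω → EuclideanSpace ℝ (Fin n)} {F : EuclideanSpace ℝ (Fin n) → ℝ}
  {ρ ρbar κ CF : ℝ} {k τmax : ℕ} {p : ℕ → ℝ}

lemma indepFun_delayError (h : IsStochasticRun μ P f r G M ξ τ a b x₀ x) (hF : Continuous F)
    {N : Ω → ℕ} (hN : IndepFun N (history ξ τ k) μ) (j : ℕ) :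
    IndepFun N (fun ω => delayError F M κ (x k ω) (x (k - j) ω)) μ := by
  have herror : Continuous fun v : EuclideanSpace ℝ (Fin n) × EuclideanSpace ℝ (Fin n) =>
      delayError F M κ v.1 v.2 := by unfold delayError; fun_prop
  have hpair : Measurable[past ξ τ k] fun ω => (x k ω, x (k - j) ω) :=
    (h.measurable_past le_rfl).prodMk (h.measurable_past (Nat.sub_le k j))
  exact (indepFun_of_measurable_comap hN hpair).comp measurable_id herror.measurable

variable [IsProbabilityMeasure μ]

lemma integrable_comp_iterate (h : IsStochasticRun μ P f r G M ξ τ a b x₀ x) (hF : Continuous F)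
    (hCF : ∀ y ∈ dom r, |F y| ≤ CF) (k : ℕ) : Integrable (fun ω => F (x k ω)) μ :=
  integrable_comp_of_abs_le hF hCF (h.measurable_iterate k) (h.mem_dom k)

lemma integrable_norm_increment (h : IsStochasticRun μ P f r G M ξ τ a b x₀ x) (k l : ℕ) :
    Integrable (fun ω => ‖x k ω - x l ω‖) μ :=
  (((h.memLp_iterate k).sub (h.memLp_iterate l)).integrable one_le_two).norm

lemma integrable_delayError (h : IsStochasticRun μ P f r G M ξ τ a b x₀ x) (hF : Continuous F)
    (hCF : ∀ y ∈ dom r, |F y| ≤ CF) (k l : ℕ) :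
    Integrable (fun ω => delayError F M κ (x k ω) (x l ω)) μ :=
  (((h.integrable_norm_increment k l).const_mul M).add
    ((h.integrable_comp_iterate hF hCF k).sub (h.integrable_comp_iterate hF hCF l))).add
      ((h.integrable_sq_increment k l).const_mul κ)

lemma integral_delayError_le (h : IsStochasticRun μ P f r G M ξ τ a b x₀ x) (hF : Continuous F)
    (hCF : ∀ y ∈ dom r, |F y| ≤ CF) (k j : ℕ) :
    ∫ ω, delayError F M κ (x k ω) (x (k - j) ω) ∂μ
      ≤ M * √(meanSqIncrement μ x k j) + (∫ ω, F (x k ω) ∂μ - ∫ ω, F (x (k - j) ω) ∂μ)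
        + κ * meanSqIncrement μ x k j := by
  have hnorm := h.integrable_norm_increment k (k - j)
  have hsq := h.integrable_sq_increment k (k - j)
  have hcurr := h.integrable_comp_iterate hF hCF k
  have hprev := h.integrable_comp_iterate hF hCF (k - j)
  simp only [delayError]
  rw [integral_add ((hnorm.const_mul M).fun_add (hcurr.sub' hprev)) (hsq.const_mul κ),
    integral_add (hnorm.const_mul M) (hcurr.sub' hprev), integral_sub hcurr hprev,
    integral_const_mul, integral_const_mul]
  exact add_le_add_left (add_le_add_left (mul_le_mul_of_nonneg_left (integral_norm_le_sqrt
    ((h.memLp_iterate k).sub (h.memLp_iterate (k - j)))) h.nonneg) _) _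

lemma integrable_integral_delayError_le (h : IsStochasticRun μ P f r G M ξ τ a b x₀ x)
    (hF : Continuous F) (hCF : ∀ y ∈ dom r, |F y| ≤ CF) (hτ : IsStochasticDelay μ ξ τ τmax p)
    (hk : 1 ≤ k) :
    Integrable (fun ω => delayError F M κ (x k ω) (x (k - τ k ω) ω)) μ ∧
      ∫ ω, delayError F M κ (x k ω) (x (k - τ k ω) ω) ∂μ
        ≤ ∑ j ∈ Finset.range (τmax + 1), p j * (M * √(meanSqIncrement μ x k j)
          + (∫ ω, F (x k ω) ∂μ - ∫ ω, F (x (k - j) ω) ∂μ) + κ * meanSqIncrement μ x k j) := by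
  have hlaw : ∀ j ∈ Finset.range (τmax + 1), μ.real {ω | τ k ω = j} = p j := fun j hj =>
    hτ.law k hk j (Finset.mem_range_succ_iff.1 hj)
  have hrange := ae_mem_of_sum_measureReal_eq_one (hτ.measurable k hk)
    ((Finset.sum_congr rfl hlaw).trans hτ.sum_eq_one)
  obtain ⟨hint, heq⟩ := integrable_integral_comp_index
    (Y := fun j ω => delayError F M κ (x k ω) (x (k - j) ω)) (hτ.measurable k hk) hrange
    (fun j _ => h.integrable_delayError hF hCF k (k - j))
    fun j _ => h.indepFun_delayError hF (hτ.indep k hk) j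
  refine ⟨hint, heq.trans_le (Finset.sum_le_sum fun j hj => ?_)⟩
  rw [hlaw j hj]
  exact mul_le_mul_of_nonneg_left (h.integral_delayError_le hF hCF k j) (hτ.prob_nonneg hj)

variable {Z : EuclideanSpace ℝ (Fin n) → EuclideanSpace ℝ (Fin n)}

lemma moreauEnvelope_step_le (h : IsStochasticRun μ P f r G M ξ τ a b x₀ x)
    (hF : WeaklyConvex ρ (expectedLoss P f)) (hρ : 0 < ρ) (hρbar : ρbar ∈ Set.Ioc ρ (2 * ρ))
    (hZ : ∀ y, IsProx (objective (expectedLoss P f) r) (1 / ρbar) y (Z y)) (hk : 1 ≤ k)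
    (haρ : a k ≤ 1 / ρbar) (hb : 0 ≤ b k) (ω : Ω) :
    moreauEnvelope (objective (expectedLoss P f) r) (1 / ρbar) (x (k + 1) ω)
      ≤ moreauEnvelope (objective (expectedLoss P f) r) (1 / ρbar) (x k ω)
        - a k * (ρbar * (ρbar - ρ) / 2 * ‖x k ω - Z (x k ω)‖ ^ 2)
        + ρbar / 2 * (2 * b k ^ 2 + 2 * (b k ^ 2 / a k) / (ρbar - ρ))
          * ‖x k ω - x (k - 1) ω‖ ^ 2
        + ρbar * (a k * (1 - a k * ρbar)) * (inner ℝ (x k ω - Z (x k ω))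
            (meanSubgradient P G τ x k ω - stochasticSubgradient G ξ τ x k ω)
          + delayError (expectedLoss P f) M (ρ / 2 + ρ ^ 2 / (ρbar - ρ)) (x k ω)
              (x (k - τ k ω) ω))
        + 2 * ρbar * a k ^ 2 * (‖stochasticSubgradient G ξ τ x k ω‖ ^ 2 + M ^ 2) := by
  have := h.isProbabilityMeasure_law
  have hdom := h.convex.convexOn_toReal.1
  have hprox := h.convex.isProxOn_objective (hZ (x k ω))
  have hdelayed := h.mem_dom (k - τ k ω) ω
  have hstep := hprox.sq_dist_delayed_step_le (hF.strongConvexOn hdom) h.convex.convexOn_toReal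
    h.nonneg (h.oracle.expectedLoss_sub_le h.nonneg h.bounded hF hdom) hρ hρbar
    (h.stepSize_pos k hk) haρ hb (h.mem_dom k ω) (h.convex.isProxOn (h.run.step k hk ω))
    (h.oracle.norm_mean_le h.nonneg h.bounded hk hdelayed)
    (le_of_mem_subdifferential (hF.strongConvexOn hdom) hdelayed hprox.1
      (h.oracle.unbiased k hk _ hdelayed))
  have hnext := moreauEnvelope_objective_le h.convex hZ (x (k + 1) ω) hprox.1
  have hcurr := h.convex.moreauEnvelope_objective_eq (hZ (x k ω))
  have hcoef : 1 / (2 * (1 / ρbar)) = ρbar / 2 := by field_simp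
  rw [hcoef, norm_sub_rev] at hnext hcurr
  simp only [delayError, meanSubgradient, stochasticSubgradient]
  linarith

lemma expected_moreauEnvelope_step_le (h : IsStochasticRun μ P f r G M ξ τ a b x₀ x)
    (hF : WeaklyConvex ρ (expectedLoss P f)) (hρ : 0 < ρ) (hρbar : ρbar ∈ Set.Ioc ρ (2 * ρ))
    (hCF : ∀ y ∈ dom r, |expectedLoss P f y| ≤ CF)
    (hZ : ∀ y, IsProx (objective (expectedLoss P f) r) (1 / ρbar) y (Z y))
    {L : NNReal} (hZL : LipschitzWith L Z)
    (hΦ : ∀ k, Integrable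
      (fun ω => moreauEnvelope (objective (expectedLoss P f) r) (1 / ρbar) (x k ω)) μ)
    (hτ : IsStochasticDelay μ ξ τ τmax p) (hk : 1 ≤ k) (haρ : a k ≤ 1 / ρbar) (hb : 0 ≤ b k) :
    ∫ ω, moreauEnvelope (objective (expectedLoss P f) r) (1 / ρbar) (x (k + 1) ω) ∂μ
      ≤ ∫ ω, moreauEnvelope (objective (expectedLoss P f) r) (1 / ρbar) (x k ω) ∂μ
        - a k * (ρbar * (ρbar - ρ) / 2 * ∫ ω, ‖x k ω - Z (x k ω)‖ ^ 2 ∂μ)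
        + ρbar / 2 * (2 * b k ^ 2 + 2 * (b k ^ 2 / a k) / (ρbar - ρ)) * meanSqIncrement μ x k 1
        + ρbar * (a k * (1 - a k * ρbar)) * ∑ j ∈ Finset.range (τmax + 1),
          p j * (M * √(meanSqIncrement μ x k j)
            + (∫ ω, expectedLoss P f (x k ω) ∂μ - ∫ ω, expectedLoss P f (x (k - j) ω) ∂μ)
            + (ρ / 2 + ρ ^ 2 / (ρbar - ρ)) * meanSqIncrement μ x k j)
        + 4 * ρbar * M ^ 2 * a k ^ 2 := by
  have hρbar0 : 0 < ρbar := hρ.trans hρbar.1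
  have hweight : 0 ≤ ρbar * (a k * (1 - a k * ρbar)) :=
    mul_nonneg hρbar0.le (mul_nonneg (h.stepSize_pos k hk).le
      (sub_nonneg.2 ((le_div_iff₀ hρbar0).1 haρ)))
  have hdist : MemLp (fun ω => x k ω - Z (x k ω)) 2 μ :=
    (h.memLp_iterate k).sub (memLp_comp_of_lipschitzWith hZL (h.memLp_iterate k))
  have hsqdist := integrable_sq_norm_of_memLp hdist
  have hsqinc := h.integrable_sq_increment k (k - 1)
  have hsqgrad := integrable_sq_norm_of_memLp (h.memLp_stochasticSubgradient hk)
  obtain ⟨hnoise, hnoise0⟩ := h.integral_inner_mean_sub hk (u := fun y => y - Z y)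
    (measurable_id.sub hZL.continuous.measurable) hdist
  obtain ⟨hdelay, hdelay_le⟩ := h.integrable_integral_delayError_le
    (κ := ρ / 2 + ρ ^ 2 / (ρbar - ρ)) hF.continuous hCF hτ hk
  have hcurr := hΦ k
  have hE := integral_mono (hΦ (k + 1)) (by fun_prop)
    (h.moreauEnvelope_step_le hF hρ hρbar hZ hk haρ hb)
  simp (disch := fun_prop) only [integral_add, integral_sub, integral_const_mul, hnoise0,
    integral_const, probReal_univ, one_smul, zero_add] at hE
  have hdelay_le := mul_le_mul_of_nonneg_left hdelay_le hweight
  have hgrad_le := mul_le_mul_of_nonneg_left (h.integral_sq_stochasticSubgradient_le hk)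
    (by positivity : 0 ≤ 2 * ρbar * a k ^ 2)
  simp only [meanSqIncrement] at hdelay_le ⊢
  linarith

end IsStochasticRun

end ExpectedDescent

section StepLengthSums

namespace IsStochasticRun

variable {n : ℕ} {Ω Ξ : Type*} [MeasurableSpace Ω] [MeasurableSpace Ξ] {μ : Measure Ω}
  {P : Measure Ξ} {f : EuclideanSpace ℝ (Fin n) → Ξ → ℝ} {r : EuclideanSpace ℝ (Fin n) → EReal}
  {G : ℕ → EuclideanSpace ℝ (Fin n) → Ξ → EuclideanSpace ℝ (Fin n)} {M : ℝ}
  {ξ : ℕ → Ω → Ξ} {τ : ℕ → Ω → ℕ} {a b : ℕ → ℝ} {x₀ : EuclideanSpace ℝ (Fin n)}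
  {x : ℕ → Ω → EuclideanSpace ℝ (Fin n)} {ρ α β Cφ Mr : ℝ} {k K : ℕ}

lemma meanSqIncrement_one_one (h : IsStochasticRun μ P f r G M ξ τ a b x₀ x) :
    meanSqIncrement μ x 1 1 = 0 := by
  simp [meanSqIncrement, h.run.zero, h.run.one]

variable [IsProbabilityMeasure μ]

lemma abs_integral_comp_iterate_le (h : IsStochasticRun μ P f r G M ξ τ a b x₀ x)
    {u : EuclideanSpace ℝ (Fin n) → ℝ} {C : ℝ} (hu : ∀ y ∈ dom r, |u y| ≤ C) (k : ℕ) :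
    |∫ ω, u (x k ω) ∂μ| ≤ C := by
  simpa using norm_integral_le_of_norm_le_const (μ := μ) (f := fun ω => u (x k ω))
    (.of_forall fun ω => hu _ (h.mem_dom k ω))

lemma expected_half_sq_step_le (h : IsStochasticRun μ P f r G M ξ τ a b x₀ x)
    (hF : WeaklyConvex ρ (expectedLoss P f)) (hβ : β < 1) (hk : 1 ≤ k) (hb : b k ∈ Set.Icc 0 β)
    (hφ : ∀ k, Integrable (fun ω => expectedLoss P f (x k ω) + (r (x k ω)).toReal) μ) :
    1 / 2 * meanSqIncrement μ x (k + 1) 1 ≤ β / 2 * meanSqIncrement μ x k 1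
      + 2 * M ^ 2 / (1 - β) * a k ^ 2
      + a k * (∫ ω, (expectedLoss P f (x k ω) + (r (x k ω)).toReal) ∂μ
        - ∫ ω, (expectedLoss P f (x (k + 1) ω) + (r (x (k + 1) ω)).toReal) ∂μ) := by
  have := h.isProbabilityMeasure_law
  have hdom := h.convex.convexOn_toReal.1
  have hnext := h.integrable_sq_increment (k + 1) k
  have hcurr := h.integrable_sq_increment k (k - 1)
  have hgrad := integrable_sq_norm_of_memLp (h.memLp_stochasticSubgradient hk)
  have hgrad_le := h.integral_sq_stochasticSubgradient_le hk
  have := hφ k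
  have hφ_next := hφ (k + 1)
  simp only [stochasticSubgradient] at hgrad hgrad_le
  have hE := integral_mono (hnext.div_const 2) (by fun_prop) fun ω =>
    IsProxOn.half_sq_norm_step_le_of_lipschitz_loss h.convex.convexOn_toReal
      (h.oracle.expectedLoss_sub_le h.nonneg h.bounded hF hdom) (h.stepSize_pos k hk) hb hβ
      (h.mem_dom k ω) (h.convex.isProxOn (h.run.step k hk ω))
  simp (disch := fun_prop) only [integral_add, integral_sub, integral_div, integral_const_mul,
    integral_const, probReal_univ, one_smul] at hE
  have hnoise : a k ^ 2 * (∫ ω, ‖G k (x (k - τ k ω) ω) (ξ k ω)‖ ^ 2 ∂μ + M ^ 2) / (1 - β)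
      ≤ 2 * M ^ 2 / (1 - β) * a k ^ 2 := by
    rw [div_mul_eq_mul_div, mul_comm (a k ^ 2), two_mul]
    have := sub_pos.2 hβ
    gcongr
  simp only [meanSqIncrement, Nat.add_sub_cancel]
  linarith

lemma expected_sq_step_le (h : IsStochasticRun μ P f r G M ξ τ a b x₀ x) (hMr : 0 ≤ Mr)
    (hr : IndicatorPlusBoundedSubgradients r Mr) (hβ : β < 1) (hk : 1 ≤ k)
    (hb : b k ∈ Set.Icc 0 β) :
    meanSqIncrement μ x (k + 1) 1 ≤ (1 + β ^ 2) / 2 * meanSqIncrement μ x k 1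
      + 2 * (1 + β ^ 2) / (1 - β ^ 2) * (Mr ^ 2 + M ^ 2) * a k ^ 2 := by
  have hβ1 : 0 < 1 - β ^ 2 := by nlinarith [hb.1.trans hb.2]
  have hcurr := h.integrable_sq_increment k (k - 1)
  have hgrad := integrable_sq_norm_of_memLp (h.memLp_stochasticSubgradient hk)
  have hgrad_le := h.integral_sq_stochasticSubgradient_le hk
  simp only [stochasticSubgradient] at hgrad hgrad_le
  have hE := integral_mono (h.integrable_sq_increment (k + 1) k) (by fun_prop) fun ω =>
    IsProxOn.sq_norm_step_le_of_lipschitz h.convex.convexOn_toReal hMr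
      (fun y hy y' hy' => hr.toReal_sub_le hy hy') (h.stepSize_pos k hk) hb hβ
      (h.mem_dom k ω) (h.convex.isProxOn (h.run.step k hk ω))
  simp (disch := fun_prop) only [integral_add, integral_const_mul, integral_const, probReal_univ,
    one_smul] at hE
  have hnoise := mul_le_mul_of_nonneg_left hgrad_le
    (by positivity : 0 ≤ 2 * (1 + β ^ 2) / (1 - β ^ 2) * a k ^ 2)
  simp only [meanSqIncrement, Nat.add_sub_cancel]
  linarith

lemma sum_meanSqIncrement_le_of_abs_objective_le (h : IsStochasticRun μ P f r G M ξ τ a b x₀ x)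
    (hF : WeaklyConvex ρ (expectedLoss P f)) (hα : 0 < α) (ha : ∀ k, 1 ≤ k → a k = α / √(k : ℝ))
    (hb : ∀ k, 1 ≤ k → b k ∈ Set.Icc 0 β) (hβ : β < 1)
    (hφ : ∀ y ∈ dom r, |expectedLoss P f y + (r y).toReal| ≤ Cφ) (hK : 1 ≤ K) :
    ∑ k ∈ Finset.range (K + 1), meanSqIncrement μ x k 1
      ≤ 4 * α * Cφ / (1 - β) + 4 * M ^ 2 / (1 - β) ^ 2 * α ^ 2 * (1 + Real.log K) := by
  have hβ0 : 0 ≤ β := (hb 1 le_rfl).1.trans (hb 1 le_rfl).2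
  have hβ1 : 0 < 1 - β := sub_pos.2 hβ
  have hint (k : ℕ) := integrable_objective_comp (μ := μ) h.convex hF.continuous hφ
    (h.measurable_iterate k) (h.mem_dom k)
  refine (sum_range_le_of_recursion hα ha hK (d := fun k => meanSqIncrement μ x k 1)
    (p := 1 / 2) (q := β / 2) (B := Cφ) (C := 2 * M ^ 2 / (1 - β))
    (w := fun k => ∫ ω, (expectedLoss P f (x k ω) + (r (x k ω)).toReal) ∂μ)
    (meanSqIncrement_zero x 1) h.meanSqIncrement_one_one (fun k => meanSqIncrement_nonneg x k 1)
    (by positivity) (by linarith) (by positivity)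
    (h.abs_integral_comp_iterate_le (u := fun y => expectedLoss P f y + (r y).toReal) hφ)
    fun k hk => h.expected_half_sq_step_le hF hβ hk (hb k hk) hint).trans_eq ?_
  rw [← sub_div]
  field_simp
  ring

lemma sum_meanSqIncrement_le_of_indicatorPlus (h : IsStochasticRun μ P f r G M ξ τ a b x₀ x)
    (hα : 0 < α) (ha : ∀ k, 1 ≤ k → a k = α / √(k : ℝ)) (hb : ∀ k, 1 ≤ k → b k ∈ Set.Icc 0 β)
    (hβ : β < 1) (hMr : 0 ≤ Mr) (hr : IndicatorPlusBoundedSubgradients r Mr) (hK : 1 ≤ K) :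
    ∑ k ∈ Finset.range (K + 1), meanSqIncrement μ x k 1
      ≤ (Mr ^ 2 + M ^ 2) * (4 * (1 + β ^ 2) / (1 - β ^ 2) ^ 2) * α ^ 2 * (1 + Real.log K) := by
  have hβ1 : 0 < 1 - β ^ 2 := by nlinarith [(hb 1 le_rfl).1.trans (hb 1 le_rfl).2]
  refine (sum_range_le_of_recursion hα ha hK (d := fun k => meanSqIncrement μ x k 1)
    (p := 1) (q := (1 + β ^ 2) / 2) (B := 0)
    (C := 2 * (1 + β ^ 2) / (1 - β ^ 2) * (Mr ^ 2 + M ^ 2)) (w := fun _ => 0)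
    (meanSqIncrement_zero x 1) h.meanSqIncrement_one_one (fun k => meanSqIncrement_nonneg x k 1)
    (by positivity) (by linarith) (by positivity) (fun _ => abs_zero.le)
    fun k hk => ?_).trans_eq ?_
  · simpa using h.expected_sq_step_le hMr hr hβ hk (hb k hk)
  · rw [show 1 - (1 + β ^ 2) / 2 = (1 - β ^ 2) / 2 by ring]
    field_simp
    ring

end IsStochasticRun

end StepLengthSums

section SummedDescent

lemma inertia_coeff_le {ρ ρbar α βt β : ℝ} {a b : ℕ → ℝ} {k : ℕ} (hρbar : 0 ≤ ρbar)
    (hρ : ρ < ρbar) (hα : 0 < α) (ha : ∀ k, 1 ≤ k → a k = α / √(k : ℝ)) (hβt : 0 ≤ βt)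
    (hβ : 0 ≤ β) (hb : ∀ k, 1 ≤ k → b k = min βt (β / (k : ℝ) ^ (1 / 4 : ℝ))) (hk : 1 ≤ k) :
    ρbar / 2 * (2 * b k ^ 2 + 2 * (b k ^ 2 / a k) / (ρbar - ρ))
      ≤ ρbar / 2 * (2 * βt ^ 2 + 2 * β ^ 2 / (α * (ρbar - ρ))) := by
  have : 0 < ρbar - ρ := sub_pos.2 hρ
  obtain ⟨hb0, hbβt⟩ := inertia_mem_Icc hβt hβ hb hk
  have hsq := inertia_sq_div_stepSize_le hα ha hβt hβ hb hk
  have hcoef : 2 * β ^ 2 / (α * (ρbar - ρ)) = 2 * (β ^ 2 / α) / (ρbar - ρ) := by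
    rw [← div_div, mul_div_assoc]
  rw [hcoef]
  gcongr

namespace IsStochasticRun

variable {n : ℕ} {Ω Ξ : Type*} [MeasurableSpace Ω] [MeasurableSpace Ξ] {μ : Measure Ω}
  [IsProbabilityMeasure μ] {P : Measure Ξ} {f : EuclideanSpace ℝ (Fin n) → Ξ → ℝ}
  {r : EuclideanSpace ℝ (Fin n) → EReal}
  {G : ℕ → EuclideanSpace ℝ (Fin n) → Ξ → EuclideanSpace ℝ (Fin n)} {M : ℝ}
  {ξ : ℕ → Ω → Ξ} {τ : ℕ → Ω → ℕ} {a b : ℕ → ℝ} {x₀ : EuclideanSpace ℝ (Fin n)}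
  {x : ℕ → Ω → EuclideanSpace ℝ (Fin n)} {Z : EuclideanSpace ℝ (Fin n) → EuclideanSpace ℝ (Fin n)}
  {ρ ρbar κ B CF S α β βt : ℝ} {k₀ K τmax : ℕ} {p : ℕ → ℝ}

lemma sum_expected_delay_error_le (h : IsStochasticRun μ P f r G M ξ τ a b x₀ x)
    (hτ : IsStochasticDelay μ ξ τ τmax p) (hCF : ∀ y ∈ dom r, |expectedLoss P f y| ≤ CF)
    (hκ : 0 ≤ κ) (hρbar : 0 ≤ ρbar) (hk₀ : 1 ≤ k₀) (hK : k₀ ≤ K)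
    (hanti : ∀ k, k₀ ≤ k → a (k + 1) ≤ a k) (haρ : ∀ k, k₀ ≤ k → a k * ρbar ≤ 1)
    (hS : ∑ k ∈ Finset.range (K + 1), meanSqIncrement μ x k 1 ≤ S) :
    ∑ k ∈ Finset.Icc k₀ K, a k * (1 - a k * ρbar) * ∑ j ∈ Finset.range (τmax + 1),
        p j * (M * √(meanSqIncrement μ x k j)
          + (∫ ω, expectedLoss P f (x k ω) ∂μ - ∫ ω, expectedLoss P f (x (k - j) ω) ∂μ)
          + κ * meanSqIncrement μ x k j)
      ≤ M * (√(∑ k ∈ Finset.Icc k₀ K, a k ^ 2) * (τmax * √S)) + 2 * (τmax * CF) * a k₀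
        + κ * a k₀ * (τmax ^ 2 * S) := by
  have ha0 (k : ℕ) (hk : k₀ ≤ k) : 0 < a k := h.stepSize_pos k (hk₀.trans hk)
  refine sum_mul_sum_mul_le (fun j hj => hτ.prob_nonneg hj) hτ.sum_eq_one fun j hj => ?_
  exact sum_mul_delay_error_le (d := fun k => meanSqIncrement μ x k 1)
    (e := fun k => ∫ ω, expectedLoss P f (x k ω) ∂μ) hK (Finset.mem_range_succ_iff.1 hj)
    (fun k hk => mul_nonneg (ha0 k hk).le (sub_nonneg.2 (haρ k hk)))
    (fun k hk => mul_le_of_le_one_right (ha0 k hk).le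
      (sub_le_self _ (mul_nonneg (ha0 k hk).le hρbar)))
    (fun k hk => abs_mul_one_sub_mul_sub_le (ha0 (k + 1) (hk.trans k.le_succ)).le (hanti k hk)
      hρbar (haρ k hk))
    (h.abs_integral_comp_iterate_le hCF) (meanSqIncrement_zero x 1)
    (fun k => meanSqIncrement_nonneg x k 1) hS (fun k => meanSqIncrement_nonneg x k j)
    (fun k => h.meanSqIncrement_le k j) h.nonneg hκ

lemma sum_expected_sq_dist_prox_le (h : IsStochasticRun μ P f r G M ξ τ a b x₀ x)
    (hF : WeaklyConvex ρ (expectedLoss P f)) (hρ : 0 < ρ) (hρbar : ρbar ∈ Set.Ioc ρ (2 * ρ))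
    (hCF : ∀ y ∈ dom r, |expectedLoss P f y| ≤ CF)
    (hZ : ∀ y, IsProx (objective (expectedLoss P f) r) (1 / ρbar) y (Z y))
    {L : NNReal} (hZL : LipschitzWith L Z)
    (hΦ : ∀ k, Integrable
      (fun ω => moreauEnvelope (objective (expectedLoss P f) r) (1 / ρbar) (x k ω)) μ)
    (hτ : IsStochasticDelay μ ξ τ τmax p) (hk₀ : 1 ≤ k₀) (hK : k₀ ≤ K)
    (hanti : ∀ k, k₀ ≤ k → a (k + 1) ≤ a k) (haρ : ∀ k, k₀ ≤ k → a k ≤ 1 / ρbar)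
    (hb : ∀ k, k₀ ≤ k → 0 ≤ b k)
    (hB : ∀ k, k₀ ≤ k → ρbar / 2 * (2 * b k ^ 2 + 2 * (b k ^ 2 / a k) / (ρbar - ρ)) ≤ B)
    (hS : ∑ k ∈ Finset.range (K + 1), meanSqIncrement μ x k 1 ≤ S) :
    ρbar * (ρbar - ρ) / 2 * ∑ k ∈ Finset.Icc k₀ K, a k * ∫ ω, ‖x k ω - Z (x k ω)‖ ^ 2 ∂μ
      ≤ ∫ ω, moreauEnvelope (objective (expectedLoss P f) r) (1 / ρbar) (x k₀ ω) ∂μ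
        - ∫ ω, moreauEnvelope (objective (expectedLoss P f) r) (1 / ρbar) (x (K + 1) ω) ∂μ
        + B * S
        + ρbar * (M * (√(∑ k ∈ Finset.Icc k₀ K, a k ^ 2) * (τmax * √S))
          + 2 * (τmax * CF) * a k₀
          + (ρ / 2 + ρ ^ 2 / (ρbar - ρ)) * a k₀ * (τmax ^ 2 * S))
        + 4 * ρbar * M ^ 2 * ∑ k ∈ Finset.Icc k₀ K, a k ^ 2 := by
  have hρbar0 : 0 < ρbar := hρ.trans hρbar.1
  have hδ : 0 < ρbar - ρ := sub_pos.2 hρbar.1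
  set Φ := fun k => ∫ ω, moreauEnvelope (objective (expectedLoss P f) r) (1 / ρbar) (x k ω) ∂μ
  have hB0 : 0 ≤ B := le_trans (by have := h.stepSize_pos k₀ hk₀; positivity) (hB k₀ le_rfl)
  have hstep := Finset.sum_le_sum fun k (hk : k ∈ Finset.Icc k₀ K) =>
    h.expected_moreauEnvelope_step_le hF hρ hρbar hCF hZ hZL hΦ hτ
      (hk₀.trans (Finset.mem_Icc.1 hk).1) (haρ k (Finset.mem_Icc.1 hk).1)
      (hb k (Finset.mem_Icc.1 hk).1)
  have hinertia : ∑ k ∈ Finset.Icc k₀ K, ρbar / 2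
      * (2 * b k ^ 2 + 2 * (b k ^ 2 / a k) / (ρbar - ρ)) * meanSqIncrement μ x k 1 ≤ B * S :=
    calc _ ≤ ∑ k ∈ Finset.Icc k₀ K, B * meanSqIncrement μ x k 1 :=
          Finset.sum_le_sum fun k hk => mul_le_mul_of_nonneg_right
            (hB k (Finset.mem_Icc.1 hk).1) (meanSqIncrement_nonneg x k 1)
      _ ≤ B * S := by
          rw [← Finset.mul_sum]
          exact mul_le_mul_of_nonneg_left ((sum_Icc_le_sum_range
            (fun k => meanSqIncrement_nonneg x k 1) k₀ K).trans hS) hB0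
  have hdelay := mul_le_mul_of_nonneg_left (h.sum_expected_delay_error_le hτ hCF
    (by positivity : 0 ≤ ρ / 2 + ρ ^ 2 / (ρbar - ρ)) hρbar0.le hk₀ hK hanti
    (fun k hk => (le_div_iff₀ hρbar0).1 (haρ k hk)) hS) hρbar0.le
  have htelescope : ∑ k ∈ Finset.Icc k₀ K, (Φ (k + 1) - Φ k) = Φ (K + 1) - Φ k₀ :=
    Finset.sum_Icc_sub hK Φ
  simp only [Finset.sum_add_distrib, Finset.sum_sub_distrib, ← Finset.mul_sum, mul_assoc,
    mul_left_comm (a _)] at hstep hinertia hdelay htelescope ⊢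
  linarith

lemma sum_expected_sq_dist_prox_le_of_stepSize (h : IsStochasticRun μ P f r G M ξ τ a b x₀ x)
    (hF : WeaklyConvex ρ (expectedLoss P f)) (hρ : 0 < ρ) (hρbar : ρbar ∈ Set.Ioc ρ (2 * ρ))
    (hbdd : ⊥ < ⨅ y, objective (expectedLoss P f) r y)
    (hCF : ∀ y ∈ dom r, |expectedLoss P f y| ≤ CF)
    (hZ : ∀ y, IsProx (objective (expectedLoss P f) r) (1 / ρbar) y (Z y))
    {L : NNReal} (hZL : LipschitzWith L Z)
    (hΦ : ∀ k, Integrable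
      (fun ω => moreauEnvelope (objective (expectedLoss P f) r) (1 / ρbar) (x k ω)) μ)
    (hτ : IsStochasticDelay μ ξ τ τmax p) (hα : 0 < α) (hα_le : α ≤ 1 / ρbar) (hβt : 0 ≤ βt)
    (hβ : 0 ≤ β) (ha : ∀ k, 1 ≤ k → a k = α / √(k : ℝ))
    (hb : ∀ k, 1 ≤ k → b k = min βt (β / (k : ℝ) ^ (1 / 4 : ℝ))) (hk₀ : 1 ≤ k₀) (hK : k₀ ≤ K)
    (hS : ∑ k ∈ Finset.range (K + 1), meanSqIncrement μ x k 1 ≤ S) :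
    ρbar * (ρbar - ρ) / 2 * ∑ k ∈ Finset.Icc k₀ K, a k * ∫ ω, ‖x k ω - Z (x k ω)‖ ^ 2 ∂μ
      ≤ ∫ ω, (moreauEnvelope (objective (expectedLoss P f) r) (1 / ρbar) (x k₀ ω)
          - optimalValue (objective (expectedLoss P f) r)) ∂μ
        + 4 * ρbar * M ^ 2 * α ^ 2 * (1 + Real.log K - Real.log k₀)
        + ρbar / 2 * (2 * βt ^ 2 + 2 * β ^ 2 / (α * (ρbar - ρ))) * S
        + 2 * (α / √(k₀ : ℝ)) * ρbar * τmax * CF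
        + α / √(k₀ : ℝ) * (τmax : ℝ) ^ 2 * ρbar * (ρ / 2 + ρ ^ 2 / (ρbar - ρ)) * S
        + α * M * τmax * ρbar * √(1 + Real.log K - Real.log k₀) * √S := by
  have hρbar0 : 0 < ρbar := hρ.trans hρbar.1
  have hM := h.nonneg
  have hsum := h.sum_expected_sq_dist_prox_le hF hρ hρbar hCF hZ hZL hΦ hτ hk₀ hK
    (fun k hk => stepSize_antitone hα ha (hk₀.trans hk) k.le_succ)
    (fun k hk => (stepSize_le hα ha (hk₀.trans hk)).trans hα_le)
    (fun k hk => (inertia_mem_Icc hβt hβ hb (hk₀.trans hk)).1)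
    (fun k hk => inertia_coeff_le hρbar0.le hρbar.1 hα ha hβt hβ hb (hk₀.trans hk)) hS
  have hsq := sum_stepSize_sq_le ha hk₀ hK
  have hroot : √(∑ k ∈ Finset.Icc k₀ K, a k ^ 2) ≤ α * √(1 + Real.log K - Real.log k₀) :=
    (Real.sqrt_le_sqrt hsq).trans_eq (by rw [Real.sqrt_mul (sq_nonneg α), Real.sqrt_sq hα.le])
  have hlast := integral_mono (integrable_const _) (hΦ (K + 1)) fun ω =>
    optimalValue_le_moreauEnvelope h.convex hbdd (one_div_pos.2 hρbar0) hZ (x (K + 1) ω)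
  have hnoise := mul_le_mul_of_nonneg_left hsq (by positivity : 0 ≤ 4 * ρbar * M ^ 2)
  have hdrift := mul_le_mul_of_nonneg_right hroot (by positivity : 0 ≤ ρbar * M * τmax * √S)
  rw [integral_const, probReal_univ, one_smul] at hlast
  rw [integral_sub (hΦ k₀) (integrable_const _), integral_const, probReal_univ, one_smul]
  rw [ha k₀ hk₀] at hsum
  linarith

end IsStochasticRun

end SummedDescent

section Output

/-- `C₁` and `C₂` are large enough for `∑_k 𝔼 ‖x⁽ᵏ⁾ - x⁽ᵏ⁻¹⁾‖² ≤ C₁ + C₂ α² (1 + ln K)` along a run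
with inertia coefficients in `[0, β]`, either because `φ` is bounded on `dom r` or because `r` is
an indicator function plus a function with bounded subgradients. -/
def AreIncrementConstants {n : ℕ} (φ r : EuclideanSpace ℝ (Fin n) → EReal)
    (M α β C₁ C₂ : ℝ) : Prop :=
  (∃ Cφ : ℝ, BoundedObjective φ r Cφ ∧
    4 * α * Cφ / (1 - β) ≤ C₁ ∧ 4 * M ^ 2 / (1 - β) ^ 2 ≤ C₂) ∨
  (∃ Mr : ℝ, 0 ≤ Mr ∧ IndicatorPlusBoundedSubgradients r Mr ∧
    0 ≤ C₁ ∧ (Mr ^ 2 + M ^ 2) * (4 * (1 + β ^ 2) / (1 - β ^ 2) ^ 2) ≤ C₂)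

lemma areIncrementConstants_of_eq {n : ℕ} {φ r : EuclideanSpace ℝ (Fin n) → EReal}
    {M α β γ C₁ C₂ : ℝ} (hr : (dom r).Nonempty) (hα : 0 ≤ α) (hγ : 0 ≤ γ) (hβ : β < 1 - γ)
    (hC : (∃ Cφ : ℝ, BoundedObjective φ r Cφ ∧
          C₁ = 4 * α * Cφ / (1 - γ - β) ∧ C₂ = 4 * M ^ 2 / (1 - γ - β) ^ 2) ∨
        (∃ Mr : ℝ, 0 ≤ Mr ∧ IndicatorPlusBoundedSubgradients r Mr ∧
          C₁ = 0 ∧ C₂ = (Mr ^ 2 + M ^ 2) * (4 * (1 + β ^ 2) / (1 - β ^ 2) ^ 2))) :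
    AreIncrementConstants φ r M α β C₁ C₂ := by
  refine hC.imp ?_ fun ⟨Mr, hMr, hsub, hC₁, hC₂⟩ => ⟨Mr, hMr, hsub, hC₁.ge, hC₂.ge⟩
  rintro ⟨Cφ, hφ, rfl, rfl⟩
  obtain ⟨y, hy⟩ := hr
  have hCφ : 0 ≤ Cφ := (abs_nonneg _).trans (hφ y hy)
  have : 0 < 1 - γ - β := by linarith
  have hle : 1 - γ - β ≤ 1 - β := by linarith
  exact ⟨Cφ, hφ, by gcongr, by gcongr⟩

lemma sum_mul_div_sum_le_of_stepSize {α c R : ℝ} {a N : ℕ → ℝ} {k₀ K : ℕ} (hα : 0 < α)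
    (ha : ∀ k, 1 ≤ k → a k = α / √(k : ℝ)) (hk₀ : 1 ≤ k₀) (hK : k₀ ≤ K) (hc : 0 < c)
    (hN : ∀ k, 0 ≤ N k) (hR : c * ∑ k ∈ Finset.Icc k₀ K, a k * N k ≤ R) :
    (∑ k ∈ Finset.Icc k₀ K, a k * N k) / ∑ k ∈ Finset.Icc k₀ K, a k
      ≤ R / (c * (2 * α * (√((K : ℝ) + 1) - √(k₀ : ℝ)))) := by
  have hroots : √(k₀ : ℝ) < √((K : ℝ) + 1) :=
    Real.sqrt_lt_sqrt k₀.cast_nonneg (by exact_mod_cast Nat.lt_succ_of_le hK)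
  have hdenom : 0 < 2 * α * (√((K : ℝ) + 1) - √(k₀ : ℝ)) := by
    have := sub_pos.2 hroots
    positivity
  have hweighted : 0 ≤ ∑ k ∈ Finset.Icc k₀ K, a k * N k := Finset.sum_nonneg fun k hk =>
    mul_nonneg (stepSize_pos hα ha (hk₀.trans (Finset.mem_Icc.1 hk).1)).le (hN k)
  calc (∑ k ∈ Finset.Icc k₀ K, a k * N k) / ∑ k ∈ Finset.Icc k₀ K, a k
      ≤ (∑ k ∈ Finset.Icc k₀ K, a k * N k) / (2 * α * (√((K : ℝ) + 1) - √(k₀ : ℝ))) :=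
        div_le_div_of_nonneg_left hweighted hdenom
          (two_mul_sqrt_sub_sqrt_le_sum_stepSize hα ha hk₀ hK)
    _ = (c * ∑ k ∈ Finset.Icc k₀ K, a k * N k)
          / (c * (2 * α * (√((K : ℝ) + 1) - √(k₀ : ℝ)))) := (mul_div_mul_left _ _ hc.ne').symm
    _ ≤ R / (c * (2 * α * (√((K : ℝ) + 1) - √(k₀ : ℝ)))) := by gcongr

variable {n : ℕ} {r : EuclideanSpace ℝ (Fin n) → EReal}

lemma ProperClosedConvex.bddBelow_toReal_of_abs_le {F : EuclideanSpace ℝ (Fin n) → ℝ} {C : ℝ}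
    (hr : ProperClosedConvex r) (hbdd : ⊥ < ⨅ y, objective F r y) (hF : ∀ y ∈ dom r, |F y| ≤ C) :
    ∃ B, ∀ y ∈ dom r, B ≤ (r y).toReal :=
  ⟨optimalValue (objective F r) - C, fun y hy => by
    linarith [hr.optimalValue_le hbdd hy, le_of_abs_le (hF y hy)]⟩

namespace IsStochasticRun

variable {Ω Ξ : Type*} [MeasurableSpace Ω] [MeasurableSpace Ξ] {μ : Measure Ω}
  [IsProbabilityMeasure μ] {P : Measure Ξ} {f : EuclideanSpace ℝ (Fin n) → Ξ → ℝ}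
  {G : ℕ → EuclideanSpace ℝ (Fin n) → Ξ → EuclideanSpace ℝ (Fin n)} {M : ℝ}
  {ξ : ℕ → Ω → Ξ} {τ : ℕ → Ω → ℕ} {a b : ℕ → ℝ} {x₀ : EuclideanSpace ℝ (Fin n)}
  {x : ℕ → Ω → EuclideanSpace ℝ (Fin n)} {T : Ω → ℕ} {ρ α β C₁ C₂ : ℝ} {k₀ K : ℕ}

lemma integrable_integral_comp_output (h : IsStochasticRun μ P f r G M ξ τ a b x₀ x)
    (hT : IsOutputIndex μ ξ τ a k₀ K T) (hk₀ : 1 ≤ k₀) (hK : k₀ ≤ K)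
    {u : EuclideanSpace ℝ (Fin n) → ℝ} (hu : Measurable u)
    (hint : ∀ k, Integrable (fun ω => u (x k ω)) μ) :
    Integrable (fun ω => u (x (T ω) ω)) μ ∧
      ∫ ω, u (x (T ω) ω) ∂μ
        = (∑ k ∈ Finset.Icc k₀ K, a k * ∫ ω, u (x k ω) ∂μ) / ∑ k ∈ Finset.Icc k₀ K, a k := by
  have hweights : 0 < ∑ k ∈ Finset.Icc k₀ K, a k :=
    Finset.sum_pos (fun k hk => h.stepSize_pos k (hk₀.trans (Finset.mem_Icc.1 hk).1))
      ⟨k₀, Finset.left_mem_Icc.2 hK⟩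
  have hprob : ∑ k ∈ Finset.Icc k₀ K, μ.real {ω | T ω = k} = 1 := by
    rw [Finset.sum_congr rfl hT.law, ← Finset.sum_div, div_self hweights.ne']
  obtain ⟨hTint, hTeq⟩ := integrable_integral_comp_index (Y := fun k ω => u (x k ω))
    hT.measurable (ae_mem_of_sum_measureReal_eq_one hT.measurable hprob) (fun k _ => hint k)
    fun k hk => (indepFun_of_measurable_comap hT.indep
      (h.measurable_past (Finset.mem_Icc.1 hk).2)).comp measurable_id hu
  refine ⟨hTint, hTeq.trans ?_⟩
  rw [Finset.sum_div]
  exact Finset.sum_congr rfl fun k hk => by rw [hT.law k hk, div_mul_eq_mul_div]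

lemma integrable_integral_sq_dist_output (h : IsStochasticRun μ P f r G M ξ τ a b x₀ x)
    (hT : IsOutputIndex μ ξ τ a k₀ K T) (hk₀ : 1 ≤ k₀) (hK : k₀ ≤ K)
    {Z : EuclideanSpace ℝ (Fin n) → EuclideanSpace ℝ (Fin n)} {L : NNReal}
    (hZ : LipschitzWith L Z) :
    Integrable (fun ω => ‖x (T ω) ω - Z (x (T ω) ω)‖ ^ 2) μ ∧
      ∫ ω, ‖x (T ω) ω - Z (x (T ω) ω)‖ ^ 2 ∂μ
        = (∑ k ∈ Finset.Icc k₀ K, a k * ∫ ω, ‖x k ω - Z (x k ω)‖ ^ 2 ∂μ)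
          / ∑ k ∈ Finset.Icc k₀ K, a k :=
  h.integrable_integral_comp_output hT hk₀ hK (u := fun y => ‖y - Z y‖ ^ 2)
    (by have := hZ.continuous; fun_prop) fun k => integrable_sq_norm_of_memLp
      ((h.memLp_iterate k).sub (memLp_comp_of_lipschitzWith hZ (h.memLp_iterate k)))

lemma sum_meanSqIncrement_le (h : IsStochasticRun μ P f r G M ξ τ a b x₀ x)
    (hF : WeaklyConvex ρ (expectedLoss P f)) (hα : 0 < α) (ha : ∀ k, 1 ≤ k → a k = α / √(k : ℝ))
    (hb : ∀ k, 1 ≤ k → b k ∈ Set.Icc 0 β) (hβ : β < 1)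
    (hC : AreIncrementConstants (objective (expectedLoss P f) r) r M α β C₁ C₂)
    (hK : 1 ≤ K) :
    ∑ k ∈ Finset.range (K + 1), meanSqIncrement μ x k 1
      ≤ C₁ + C₂ * α ^ 2 * (1 + Real.log K) := by
  have : 0 ≤ 1 + Real.log K := by positivity
  obtain ⟨Cφ, hφ, hC₁, hC₂⟩ | ⟨Mr, hMr, hr, hC₁, hC₂⟩ := hC
  · refine (h.sum_meanSqIncrement_le_of_abs_objective_le hF hα ha hb hβ (fun y hy => ?_)
      hK).trans (by gcongr)
    rw [← toReal_objective (h.convex.ne_bot y) hy]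
    exact hφ y hy
  · refine (h.sum_meanSqIncrement_le_of_indicatorPlus hα ha hb hβ hMr hr hK).trans ?_
    rw [← zero_add (_ * _)]
    gcongr

end IsStochasticRun

end Output

end InertialSsGM

theorem mainTheorem5_general {n : ℕ} {Ω Ξ : Type*} [MeasurableSpace Ω] [MeasurableSpace Ξ]
    (μ : Measure Ω) [IsProbabilityMeasure μ] (P : Measure Ξ)
    (f : EuclideanSpace ℝ (Fin n) → Ξ → ℝ) (_hf : ∀ x, Integrable (f x) P)
    (F : EuclideanSpace ℝ (Fin n) → ℝ) (hF : F = expectedLoss P f)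
    (r : EuclideanSpace ℝ (Fin n) → EReal) (hr : ProperClosedConvex r)
    (φ : EuclideanSpace ℝ (Fin n) → EReal) (hφ : φ = objective F r)
    (hφ_bdd : ⊥ < ⨅ x, φ x)
    (ρ : ℝ) (hρ : 0 < ρ) (hF_weak : WeaklyConvex ρ F)
    (G : ℕ → EuclideanSpace ℝ (Fin n) → Ξ → EuclideanSpace ℝ (Fin n))
    (hG : IsUnbiasedOracle P f r G)
    (M : ℝ) (hM : 0 ≤ M) (hG_bdd : BoundedSubgradients P f r M)
    (ξ : ℕ → Ω → Ξ) (τ : ℕ → Ω → ℕ) (τmax : ℕ) (p : ℕ → ℝ)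
    (hξ : IsSampling μ P ξ τ) (hτ : IsStochasticDelay μ ξ τ τmax p)
    (ρbar : ℝ) (hρbar : ρbar ∈ Set.Ioc ρ (2 * ρ))
    (α : ℝ) (hα : 0 < α) (hα_le : α ≤ 1 / ρbar)
    (βt β : ℝ) (hβt : 0 ≤ βt) (hβt_lt : βt < 1) (hβ : 0 ≤ β)
    (a b : ℕ → ℝ) (ha : ∀ k, 1 ≤ k → a k = α / √(k : ℝ))
    (hb : ∀ k, 1 ≤ k → b k = min βt (β / (k : ℝ) ^ (1 / 4 : ℝ)))
    (CF : ℝ) (hCF : ∀ x ∈ dom r, |F x| ≤ CF)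
    (C₁ C₂ : ℝ)
    (hC : AreIncrementConstants φ r M α βt C₁ C₂)
    (x₀ : EuclideanSpace ℝ (Fin n)) (x : ℕ → Ω → EuclideanSpace ℝ (Fin n))
    (hx : IsRun r G ξ τ a b x₀ x)
    (k₀ K : ℕ) (hk₀ : 1 ≤ k₀) (hK : k₀ ≤ K)
    (T : Ω → ℕ) (hT : IsOutputIndex μ ξ τ a k₀ K T) :
    Differentiable ℝ (moreauEnvelope φ (1 / ρbar)) ∧
    Integrable (fun ω => moreauEnvelope φ (1 / ρbar) (x k₀ ω)) μ ∧
    Integrable (fun ω => ‖gradient (moreauEnvelope φ (1 / ρbar)) (x (T ω) ω)‖ ^ 2) μ ∧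
    ∫ ω, ‖gradient (moreauEnvelope φ (1 / ρbar)) (x (T ω) ω)‖ ^ 2 ∂μ ≤
      ρbar / ((ρbar - ρ) * α * (√((K : ℝ) + 1) - √(k₀ : ℝ))) *
        ((∫ ω, (moreauEnvelope φ (1 / ρbar) (x k₀ ω) - optimalValue φ) ∂μ)
          + 4 * ρbar * M ^ 2 * α ^ 2 * (1 + Real.log K - Real.log k₀)
          + ρbar / 2 * (2 * βt ^ 2 + 2 * β ^ 2 / (α * (ρbar - ρ)))
              * (C₁ + C₂ * α ^ 2 * (1 + Real.log K))
          + 2 * (α / √(k₀ : ℝ)) * ρbar * τmax * CF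
          + α / √(k₀ : ℝ) * (τmax : ℝ) ^ 2 * ρbar * (ρ / 2 + ρ ^ 2 / (ρbar - ρ))
              * (C₁ + C₂ * α ^ 2 * (1 + Real.log K))
          + α * M * τmax * ρbar * √(1 + Real.log K - Real.log k₀)
              * √(C₁ + C₂ * α ^ 2 * (1 + Real.log K))) := by
  subst hF hφ
  have hρbar0 : 0 < ρbar := hρ.trans hρbar.1
  have hlam : 0 < 1 / ρbar := one_div_pos.2 hρbar0
  have hlamρ : 1 / ρbar * ρ < 1 := by rw [one_div_mul_eq_div, div_lt_one hρbar0]; exact hρbar.1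
  have h : IsStochasticRun μ P f r G M ξ τ a b x₀ x := ⟨hr, hr.bddBelow_toReal_of_abs_le hφ_bdd hCF,
    hG, hM, hG_bdd, hξ, hτ.measurable, fun k hk => stepSize_pos hα ha hk, hx⟩
  choose Z hZ using exists_isProx_objective hr hF_weak.continuous hφ_bdd hlam
  obtain ⟨L, hZL⟩ := exists_lipschitzWith_prox_objective hr hF_weak hlam hlamρ hZ
  have hdiff := differentiable_moreauEnvelope hr hF_weak hlam hlamρ hZ
  have hgrad := sq_norm_gradient_moreauEnvelope hr hF_weak hlam hlamρ hZ
  have hΦ (k : ℕ) :=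
    integrable_moreauEnvelope_comp hr hφ_bdd hlam hZ hdiff.continuous (h.memLp_iterate k)
  obtain ⟨hTint, hTeq⟩ := h.integrable_integral_sq_dist_output hT hk₀ hK hZL
  have hsum := h.sum_expected_sq_dist_prox_le_of_stepSize hF_weak hρ hρbar hφ_bdd hCF hZ hZL hΦ hτ
    hα hα_le hβt hβ ha hb hk₀ hK (h.sum_meanSqIncrement_le hF_weak hα ha
      (fun k hk => inertia_mem_Icc hβt hβ hb hk) hβt_lt hC (hk₀.trans hK))
  have hmean := sum_mul_div_sum_le_of_stepSize hα ha hk₀ hK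
    (by have := sub_pos.2 hρbar.1; positivity) (fun k => integral_nonneg fun ω => sq_nonneg _) hsum
  simp only [hgrad, integral_const_mul, hTeq]
  refine ⟨hdiff, hΦ k₀, hTint.const_mul _,
    (mul_le_mul_of_nonneg_left hmean (sq_nonneg _)).trans_eq ?_⟩
  field_simp

theorem mainTheorem5 {n : ℕ} {Ω Ξ : Type*} [MeasurableSpace Ω] [MeasurableSpace Ξ]
    (μ : Measure Ω) [IsProbabilityMeasure μ] (P : Measure Ξ) [IsProbabilityMeasure P]
    -- the problem: minimize `φ = F + r` with `F = 𝔼 f(·; ξ)`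
    (f : EuclideanSpace ℝ (Fin n) → Ξ → ℝ) (hf : ∀ x, Integrable (f x) P)
    (F : EuclideanSpace ℝ (Fin n) → ℝ) (hF : F = expectedLoss P f)
    (r : EuclideanSpace ℝ (Fin n) → EReal) (hr : ProperClosedConvex r)
    (φ : EuclideanSpace ℝ (Fin n) → EReal) (hφ : φ = objective F r)
    (hφ_bdd : ⊥ < ⨅ x, φ x)
    -- weak convexity, unbiased and bounded stochastic subgradients, stochastic delay
    (ρ : ℝ) (hρ : 0 < ρ) (hF_weak : WeaklyConvex ρ F)
    (G : ℕ → EuclideanSpace ℝ (Fin n) → Ξ → EuclideanSpace ℝ (Fin n))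
    (hG : IsUnbiasedOracle P f r G)
    (M : ℝ) (hM : 0 ≤ M) (hG_bdd : BoundedSubgradients P f r M)
    (ξ : ℕ → Ω → Ξ) (τ : ℕ → Ω → ℕ) (τmax : ℕ) (p : ℕ → ℝ)
    (hξ : IsSampling μ P ξ τ) (hτ : IsStochasticDelay μ ξ τ τmax p)
    -- parameters
    (ρbar : ℝ) (hρbar : ρbar ∈ Set.Ioc ρ (2 * ρ))
    (α : ℝ) (hα : 0 < α) (hα_le : α ≤ 1 / ρbar)
    (βt β : ℝ) (hβt : 0 ≤ βt) (hβt_lt : βt < 1 - α * ρ / 2) (hβ : 0 ≤ β)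
    (a b : ℕ → ℝ) (ha : ∀ k, 1 ≤ k → a k = α / √(k : ℝ))
    (hb : ∀ k, 1 ≤ k → b k = min βt (β / (k : ℝ) ^ (1 / 4 : ℝ)))
    (CF : ℝ) (hCF : ∀ x ∈ dom r, |F x| ≤ CF)
    -- at least one of the two additional conditions, with the resulting constants `C₁`, `C₂`
    (C₁ C₂ : ℝ)
    (hC : (∃ Cφ : ℝ, BoundedObjective φ r Cφ ∧
          C₁ = 4 * α * Cφ / (1 - α * ρ / 2 - βt) ∧
          C₂ = 4 * M ^ 2 / (1 - α * ρ / 2 - βt) ^ 2) ∨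
        (∃ Mr : ℝ, 0 ≤ Mr ∧ IndicatorPlusBoundedSubgradients r Mr ∧
          C₁ = 0 ∧
          C₂ = (Mr ^ 2 + M ^ 2) * (4 * (1 + βt ^ 2) / (1 - βt ^ 2) ^ 2)))
    -- the iterates and the randomly selected output index
    (x₀ : EuclideanSpace ℝ (Fin n)) (x : ℕ → Ω → EuclideanSpace ℝ (Fin n))
    (hx : IsRun r G ξ τ a b x₀ x)
    (k₀ K : ℕ) (hk₀ : 1 ≤ k₀) (hK : k₀ ≤ K)
    (T : Ω → ℕ) (hT : IsOutputIndex μ ξ τ a k₀ K T) :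
    Differentiable ℝ (moreauEnvelope φ (1 / ρbar)) ∧
    Integrable (fun ω => moreauEnvelope φ (1 / ρbar) (x k₀ ω)) μ ∧
    Integrable (fun ω => ‖gradient (moreauEnvelope φ (1 / ρbar)) (x (T ω) ω)‖ ^ 2) μ ∧
    ∫ ω, ‖gradient (moreauEnvelope φ (1 / ρbar)) (x (T ω) ω)‖ ^ 2 ∂μ ≤
      ρbar / ((ρbar - ρ) * α * (√((K : ℝ) + 1) - √(k₀ : ℝ))) *
        ((∫ ω, (moreauEnvelope φ (1 / ρbar) (x k₀ ω) - optimalValue φ) ∂μ)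
          + 4 * ρbar * M ^ 2 * α ^ 2 * (1 + Real.log K - Real.log k₀)
          + ρbar / 2 * (2 * βt ^ 2 + 2 * β ^ 2 / (α * (ρbar - ρ)))
              * (C₁ + C₂ * α ^ 2 * (1 + Real.log K))
          + 2 * (α / √(k₀ : ℝ)) * ρbar * τmax * CF
          + α / √(k₀ : ℝ) * (τmax : ℝ) ^ 2 * ρbar * (ρ / 2 + ρ ^ 2 / (ρbar - ρ))
              * (C₁ + C₂ * α ^ 2 * (1 + Real.log K))
          + α * M * τmax * ρbar * √(1 + Real.log K - Real.log k₀)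
              * √(C₁ + C₂ * α ^ 2 * (1 + Real.log K))) := by
  have hαρ : 0 ≤ α * ρ / 2 := by positivity
  exact mainTheorem5_general μ P f hf F hF r hr φ hφ hφ_bdd ρ hρ hF_weak G hG M hM hG_bdd ξ τ τmax p
    hξ hτ ρbar hρbar α hα hα_le βt β hβt (by linarith) hβ a b ha hb CF hCF C₁ C₂
    (areIncrementConstants_of_eq ⟨x₀, hx.init_mem⟩ hα.le hαρ hβt_lt hC) x₀ x hx k₀ K hk₀ hK T hT
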